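/- Let $n\ge 1$ and let $\sigma:\mathbb R\to\mathbb C^{n\times n}$ be a nondecreasing matrix-valued function (its increments are positive semidefinite) with infinitely many growth points, such that all moments $S_k=\int_{\mathbb R}t^k\,d\sigma$ ($k\ge 0$) are finite and real, and $S_0$ is invertible. For vector polynomials put $\langle r,s\rangle=\sum_{i,j}\int\overline{r_i}\,s_j\,d\sigma_{ij}$, the inner product of $L_2(\mathbb R,\sigma)$. Apply the Gram–Schmidt procedure to the vector polynomials $\boldsymbol e_{nk+i}(z)=z^k\boldsymbol e_i$ ($k\ge0$, $1\le i\le n$), in this order. Let $\tilde p_1,\tilde p_2,\dots$ be the normalized outputs of nonzero norm, in order, and let $\tilde q_1,\tilde q_2,\dots$ be those outputs of zero norm whose step is not congruent modulo $n$ to the step of an earlier output of zero norm. Then: (a) There is exactly one array of complex numbers $(c_{ik})_{i,k\ge1}$ such that for every $k$ only finitely many $c_{ik}$ are nonzero and $$z\tilde p_k(z)=\sum_i c_{ik}\tilde p_i(z)+\sum_j R_{kj}(z)\tilde q_j(z)$$ for some scalar polynomials $R_{kj}$, finitely many of them nonzero. (b) The $c_{kl}$ are real and $c_{kl}=c_{lk}$,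 and $c_{kl}=0$ if $|k-l|>n$. With $d_k^{(i)}:=c_{k+i,k}$ there are $0\le j_0\le n-1$ and $0=:m_0<m_1<\dots<m_{j_0}$ such that, for $0\le j<j_0$, $d_k^{(n-j)}>0$ if $m_j<k<m_{j+1}$ and $d_k^{(n-j)}=0$ if $k\ge m_{j+1}$, while $d_k^{(n-j_0)}>0$ for all $k>m_{j_0}$. If moreover no vector polynomial of the form $z\boldsymbol e_1+a$ with $a\in\mathbb C^n$ has zero norm in $L_2(\mathbb R,\sigma)$, then $m_1>1$ (if $j_0\ge1$), that is, $\{c_{kl}\}\in\mathcal M(n,\infty)$. (c) $\sigma$ is a spectral function of $\{c_{kl}\}$: there is a real upper triangular $n\times n$ matrix $\mathscr T$ with nonzero diagonal entries such that, if $p_1,p_2,\dots$ is the sequence of vector polynomials with $p_k=\mathscr T\boldsymbol e_k$ for $k\le n$ and $\sum_l c_{kl}p_l(z)=z\,p_k(z)$ for all $k\notin\{m_1,\dots,m_{j_0}\}$, then $\langle p_k,p_l\rangle=\delta_{kl}$ for all $k,l$, and for $1\le j\le j_0$ the vector polynomial $$q_j(z)=z\,p_{m_j}(z)-\sum_{l\le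 m_j+n-j}c_{m_jl}\,p_l(z)$$ satisfies $\langle q_j,q_j\rangle=0$. -/

import Mathlib

open Polynomial
open scoped ComplexOrder

namespace BandSpectral

noncomputable section

/-- A nondecreasing function `σ : ℝ → ℂ^{n × n}`: for `s ≤ t` the increment `σ t - σ s` is
(Hermitian) positive semidefinite. -/
structure MatrixDistribution (n : ℕ) where
  /-- the underlying matrix-valued function -/
  toFun : ℝ → Matrix (Fin n) (Fin n) ℂ
  mono' : ∀ ⦃s t : ℝ⦄, s ≤ t → (toFun t - toFun s).PosSemidef

namespace MatrixDistribution

variable {n : ℕ} (σ : MatrixDistribution n)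

/-- The scalar function `t ↦ v* σ(t) v`. -/
def quad (v : Fin n → ℂ) (t : ℝ) : ℝ := (star v ⬝ᵥ (σ.toFun t).mulVec v).re

theorem quad_mono (v : Fin n → ℂ) : Monotone (σ.quad v) := by
  intro s t hst
  have h := (σ.mono' hst).re_dotProduct_nonneg v
  simp only [Matrix.sub_mulVec, dotProduct_sub, map_sub, sub_nonneg] at h
  exact h

/-- The Lebesgue-Stieltjes measure on `ℝ` of the nondecreasing scalar function
`t ↦ v* σ(t) v`. -/
def quadMeasure (v : Fin n → ℂ) : MeasureTheory.Measure ℝ :=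
  (σ.quad_mono v).stieltjesFunction.measure

/-- The integral `∫ f dσ(i,j)` of a scalar function with respect to the `(i,j)` entry of `σ`.
The entry is recovered from the quadratic forms by polarization:
`σ(i,j) = (1/4) ∑_{ω ∈ {1, I, -1, -I}} conj ω · (e_i + ω e_j)* σ (e_i + ω e_j)`. -/
def entryIntegral (i j : Fin n) (f : ℝ → ℂ) : ℂ :=
  (1 / 4) * ∑ r ∈ Finset.range 4, (starRingEnd ℂ) (Complex.I ^ r) *
    ∫ t, f t ∂(σ.quadMeasure (Pi.single i 1 + Complex.I ^ r • Pi.single j 1))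

/-- All the moments of `σ` are finite. -/
def FiniteMoments : Prop :=
  ∀ (v : Fin n → ℂ) (k : ℕ), MeasureTheory.Integrable (fun t : ℝ => t ^ k) (σ.quadMeasure v)

/-- The matrix moment `S_k = ∫ t^k dσ`. -/
def moment (k : ℕ) : Matrix (Fin n) (Fin n) ℂ :=
  Matrix.of fun i j => σ.entryIntegral i j (fun t => (t : ℂ) ^ k)

/-- `t` is a growth point of `σ`: `σ` is not constant near `t`. -/
def IsGrowthPoint (t : ℝ) : Prop :=
  ∀ ε : ℝ, 0 < ε → σ.toFun (t + ε) ≠ σ.toFun (t - ε)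

/-- The class `𝔐(n,∞)`: nondecreasing matrix functions with infinitely many growth points, finite
moments and invertible `S_0`. -/
structure InClass : Prop where
  infinite_growth : {t : ℝ | σ.IsGrowthPoint t}.Infinite
  finite_moments : σ.FiniteMoments
  isUnit_moment_zero : IsUnit (σ.moment 0)

/-- The inner product of `L_2(ℝ, σ)` on `n`-dimensional vector polynomials, antilinear in the first
argument: `⟨r, s⟩ = ∑_{i,j} ∫ conj (r_i(t)) s_j(t) dσ(i,j)(t)`. -/
def inner (r s : Fin n → ℂ[X]) : ℂ :=
  ∑ i, ∑ j, σ.entryIntegral i j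
    (fun t => (starRingEnd ℂ) ((r i).eval (t : ℂ)) * (s j).eval (t : ℂ))

/-- The squared norm in `L_2(ℝ, σ)` of a vector polynomial. -/
def normSq (r : Fin n → ℂ[X]) : ℝ := (σ.inner r r).re

end MatrixDistribution

/-- The vector polynomials `z^l e_i`, enumerated by height: `canon n k = z^(k / n) e_(k % n)`
for `k = 0, 1, 2, …`. -/
def canon (n : ℕ) [NeZero n] (k : ℕ) : Fin n → ℂ[X] :=
  Pi.single (Fin.ofNat n k) (X ^ (k / n))

section GramSchmidt

variable {n : ℕ} [NeZero n] (σ : MatrixDistribution n)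

/-- Gram-Schmidt without normalization, applied to `canon n 0, canon n 1, …` in `L_2(ℝ, σ)`: from
each vector one subtracts its components along the normalized earlier outputs of nonzero norm
(an earlier output of zero norm contributes `0`, since its normalizing factor is `0⁻¹ = 0`). -/
def gs (k : ℕ) : Fin n → ℂ[X] :=
  canon n k - ∑ i : Fin k,
    σ.inner ((((Real.sqrt (σ.normSq (gs i)))⁻¹ : ℝ) : ℂ) • gs i) (canon n k) •
      ((((Real.sqrt (σ.normSq (gs i)))⁻¹ : ℝ) : ℂ) • gs i)
termination_by k
decreasing_by all_goals exact i.2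

/-- The orthonormal sequence `p̃_k`, `k = 0, 1, 2, …`: the outputs of Gram-Schmidt of nonzero norm,
normalized and listed in the order in which they are produced. -/
def ptilde (k : ℕ) : Fin n → ℂ[X] :=
  let κ := Nat.nth (fun i => σ.normSq (gs σ i) ≠ 0) k
  (((Real.sqrt (σ.normSq (gs σ κ)))⁻¹ : ℝ) : ℂ) • gs σ κ

/-- The output of Gram-Schmidt at step `k` is one of the null vectors `q̃_j`: it has zero norm and
its height `k` is not of the form `h(q̃) + n l`, `l ≥ 1`, for an earlier null vector `q̃`. -/
def IsNullStep (k : ℕ) : Prop :=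
  σ.normSq (gs σ k) = 0 ∧ ∀ i < k, σ.normSq (gs σ i) = 0 → ¬ i ≡ k [MOD n]

/-- `c` is the array of coefficients of the recurrence
`z p̃_k = ∑_i c_{ik} p̃_i + ∑_j R_{kj} q̃_j` (finite sums, `R_{kj}` scalar polynomials). -/
def IsRecurrenceCoeff (c : ℕ → ℕ → ℂ) : Prop :=
  ∀ k : ℕ, ∃ (L : ℕ) (R : ℕ →₀ ℂ[X]),
    (∀ i, L ≤ i → c i k = 0) ∧ (∀ j ∈ R.support, IsNullStep σ j) ∧
    (X : ℂ[X]) • ptilde σ k =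
      ∑ i ∈ Finset.range L, c i k • ptilde σ i + R.sum (fun j r => r • gs σ j)

end GramSchmidt

/-- `A` is a real symmetric matrix with `2 n + 1` band diagonals that degenerate at the rows
`m 0 < m 1 < … < m (j₀ - 1)`, `j₀ ≤ n - 1`. Rows and columns are numbered from `0`, so that
`d_{k+1}^{(i)} = A (k + i) k` and `m j` stands for `m_{j+1} - 1`. The condition `m_1 > 1` is not
part of this definition. -/
structure IsDegenerateBand (n : ℕ) (A : ℕ → ℕ → ℝ) (j₀ : ℕ) (m : Fin j₀ → ℕ) : Prop where
  symm : ∀ k l, A k l = A l k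
  band : ∀ k l, k + n < l → A k l = 0
  lt : j₀ < n
  strictMono : StrictMono m
  /-- the diagonal `n - j` is positive strictly between the `j`th and the next degeneration -/
  pos : ∀ (j : Fin j₀) (k : ℕ), (∀ i < j, m i < k) → k < m j → 0 < A (k + (n - (j : ℕ))) k
  /-- and it vanishes from the latter on -/
  zero : ∀ (j : Fin j₀) (k : ℕ), m j ≤ k → A (k + (n - (j : ℕ))) k = 0
  /-- the diagonal `n - j₀` does not degenerate -/
  pos_last : ∀ k : ℕ, (∀ i, m i < k) → 0 < A (k + (n - j₀)) k

/-- The class `𝓜(n,∞)`, including the condition `m_1 > 1`. -/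
def InBandClass (n : ℕ) (A : ℕ → ℕ → ℝ) : Prop :=
  ∃ (j₀ : ℕ) (m : Fin j₀ → ℕ), IsDegenerateBand n A j₀ m ∧ ∀ j, 0 < m j

/-- `T` is real upper triangular with nonzero diagonal entries. -/
def IsInitialMatrix {n : ℕ} (T : Matrix (Fin n) (Fin n) ℝ) : Prop :=
  (∀ i j, j < i → T i j = 0) ∧ ∏ i, T i i ≠ 0

/-- `p` is the sequence of vector polynomials with `p_k = T e_k` for the first `n` indices that
satisfies the recurrence `∑_l A_{kl} p_l = z p_k` for every row `k` other than the degeneration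
rows `m j`. (These conditions determine `p` when `A` is a degenerate band matrix.) -/
def IsPolynomialSolution {n : ℕ} (A : ℕ → ℕ → ℝ) {j₀ : ℕ} (m : Fin j₀ → ℕ)
    (T : Matrix (Fin n) (Fin n) ℝ) (p : ℕ → Fin n → ℂ[X]) : Prop :=
  (∀ k : Fin n, p k = fun i => C ((T i k : ℝ) : ℂ)) ∧
  ∀ k : ℕ, (∀ j, m j ≠ k) →
    ∑ l ∈ Finset.range (k + n + 1), ((A k l : ℝ) : ℂ) • p l = (X : ℂ[X]) • p k

/-- The vector polynomial `q_j`, defined by the part of the recurrence at the degeneration row `m j`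
that is known there. -/
def qpoly {n : ℕ} (A : ℕ → ℕ → ℝ) {j₀ : ℕ} (m : Fin j₀ → ℕ) (p : ℕ → Fin n → ℂ[X])
    (j : Fin j₀) : Fin n → ℂ[X] :=
  (X : ℂ[X]) • p (m j) -
    ∑ l ∈ Finset.range (m j + (n - (j : ℕ))), ((A (m j) l : ℝ) : ℂ) • p l

/-- `σ` is a spectral function of the degenerate band matrix `A`: it has finite moments and
invertible `∫ dσ`, and for some `T` the sequence `p_k` is orthonormal in `L_2(ℝ, σ)` and every `q_j`
is in the zero class of `L_2(ℝ, σ)`. -/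
def IsSpectralFunction {n : ℕ} (σ : MatrixDistribution n) (A : ℕ → ℕ → ℝ) : Prop :=
  σ.FiniteMoments ∧ IsUnit (σ.moment 0) ∧
  ∃ (j₀ : ℕ) (m : Fin j₀ → ℕ), IsDegenerateBand n A j₀ m ∧
    ∃ (T : Matrix (Fin n) (Fin n) ℝ) (p : ℕ → Fin n → ℂ[X]),
      IsInitialMatrix T ∧ IsPolynomialSolution A m T p ∧
      (∀ k l : ℕ, σ.inner (p k) (p l) = if k = l then 1 else 0) ∧
      ∀ j : Fin j₀, σ.inner (qpoly A m p j) (qpoly A m p j) = 0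

end

end BandSpectral

/-!
The form `⟨r, s⟩` is shown to be a positive semidefinite Hermitian form on vector polynomials for
which multiplication by `z` is symmetric. Linear relations between the functions `v* σ v` pass to
the integrals (`StieltjesFunction.sum_mul_integral_eq_zero`), so the integral with respect to
`v* σ v` is the quadratic form of the entry integrals (`integral_quadMeasure`). Hence `⟨F, F⟩ ≥ 0`
for vector-valued simple functions `F`, and by dominated convergence for vector polynomials
(`inner_self_nonneg`). The null vectors form a module over the scalar polynomials. Infinitely many
Gram-Schmidt outputs have nonzero norm: otherwise every unit vector would have a nonzero polynomial
multiple that is null, and all growth points would be among the zeros of these polynomials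
(`exists_single_not_null`).

If step `k` gives a null vector, so does step `k + n`. By induction on the height, the orthonormal
sequence spans everything modulo the module generated by the null steps
(`span_ptilde_sup_nullSpan`), which gives the recurrence; pairing it with `ptilde i` shows that
the coefficients can only be `c i k = ⟨ptilde i, z ptilde k⟩`. They are real because Gram-Schmidt
preserves real coefficients when the moments are real.

The last possibly nonzero entry of column `k` corresponds to the step `height k + n`. It is positive
when that step has nonzero norm; otherwise `k` is a degeneration row (`IsDefect`) and the column
ends earlier. Counting the steps of nonzero norm below `height k + n` (`count_add_count_defect`)
places this entry on the diagonal `n - #{i < k : i is a degeneration row}`, and since the diagonal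
itself is still within the band there are fewer than `n` degeneration rows
(`isDegenerateBand_bandMatrix`). The first row is degenerate only if step `n` has norm zero, and
its output is of the form `z e_1 + a`.

Outside the degeneration rows the recurrence can be solved for its last term. The solution with the
initial values of the orthonormal sequence differs from this sequence by null vectors only
(`spectralPolynomial_sub_ptilde_mem`), hence it is orthonormal too, and the part of the recurrence
at a degeneration row is a null vector.
-/

/-! ### Linear relations between Stieltjes functions -/

namespace StieltjesFunction

open MeasureTheory

theorem measure_sum_smul {ι : Type*} (s : Finset ι) (a : ι → NNReal) (G : ι → StieltjesFunction ℝ) :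
    (∑ k ∈ s, a k • G k).measure = ∑ k ∈ s, (a k : ENNReal) • (G k).measure := by
  classical
  induction s using Finset.induction_on with
  | empty => simp
  | insert k s hk ih =>
    rw [Finset.sum_insert hk, Finset.sum_insert hk, StieltjesFunction.measure_add, ih,
      StieltjesFunction.measure_smul]
    rfl

theorem sum_smul_apply {ι : Type*} (s : Finset ι) (a : ι → NNReal) (G : ι → StieltjesFunction ℝ)
    (t : ℝ) : (∑ k ∈ s, a k • G k) t = ∑ k ∈ s, (a k : ℝ) * G k t := by
  classical
  induction s using Finset.induction_on with
  | empty => rfl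
  | insert k s hk ih =>
    rw [Finset.sum_insert hk, Finset.sum_insert hk, ← ih]
    rfl

theorem sum_mul_integral_eq_zero_real {ι : Type*} (s : Finset ι) (a : ι → ℝ)
    (G : ι → StieltjesFunction ℝ) (hG : ∀ t, ∑ k ∈ s, a k * G k t = 0) {f : ℝ → ℂ}
    (hf : ∀ k ∈ s, Integrable f (G k).measure) :
    ∑ k ∈ s, (a k : ℂ) * ∫ t, f t ∂(G k).measure = 0 := by
  -- Separating positive and negative coefficients turns the relation into an equality of measures.
  have key : (∑ k ∈ s, (a k).toNNReal • G k) = ∑ k ∈ s, (-a k).toNNReal • G k := by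
    ext t
    rw [sum_smul_apply, sum_smul_apply, ← sub_eq_zero, ← Finset.sum_sub_distrib, ← hG t]
    refine Finset.sum_congr rfl fun k _ => ?_
    rw [← sub_mul, Real.coe_toNNReal', Real.coe_toNNReal', max_zero_sub_max_neg_zero_eq_self]
  have hint (b : ι → NNReal) : ∫ t, f t ∂(∑ k ∈ s, b k • G k).measure =
      ∑ k ∈ s, (b k : ℂ) * ∫ t, f t ∂(G k).measure := by
    rw [measure_sum_smul, integral_finsetSum_measure]
    · refine Finset.sum_congr rfl fun k _ => ?_
      rw [integral_smul_measure]
      simp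
    · exact fun k hk => (hf k hk).smul_measure ENNReal.coe_ne_top
  have h := hint fun k => (a k).toNNReal
  rw [key, hint, ← sub_eq_zero, ← Finset.sum_sub_distrib] at h
  rw [← neg_eq_zero, ← h, ← Finset.sum_neg_distrib]
  refine Finset.sum_congr rfl fun k _ => ?_
  rw [← sub_mul, ← neg_mul]
  congr 1
  have := max_zero_sub_max_neg_zero_eq_self (a k)
  simp only [Real.coe_toNNReal']
  rw [← Complex.ofReal_sub, ← Complex.ofReal_neg]
  congr 1
  linarith

/-- A complex linear relation between Stieltjes functions passes to the integrals of any function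
that is integrable with respect to all the measures involved. -/
theorem sum_mul_integral_eq_zero {ι : Type*} (s : Finset ι) (a : ι → ℂ)
    (G : ι → StieltjesFunction ℝ) (hG : ∀ t, ∑ k ∈ s, a k * (G k t : ℂ) = 0) {f : ℝ → ℂ}
    (hf : ∀ k ∈ s, Integrable f (G k).measure) :
    ∑ k ∈ s, a k * ∫ t, f t ∂(G k).measure = 0 := by
  have hre := sum_mul_integral_eq_zero_real s (fun k => (a k).re) G
    (fun t => by simpa using congrArg Complex.re (hG t)) hf
  have him := sum_mul_integral_eq_zero_real s (fun k => (a k).im) G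
    (fun t => by simpa using congrArg Complex.im (hG t)) hf
  have : ∑ k ∈ s, a k * ∫ t, f t ∂(G k).measure =
      (∑ k ∈ s, ((a k).re : ℂ) * ∫ t, f t ∂(G k).measure) +
        Complex.I * ∑ k ∈ s, ((a k).im : ℂ) * ∫ t, f t ∂(G k).measure := by
    rw [Finset.mul_sum, ← Finset.sum_add_distrib]
    refine Finset.sum_congr rfl fun k _ => ?_
    conv_lhs => rw [← Complex.re_add_im (a k)]
    ring
  rw [this, hre, him, mul_zero, add_zero]

end StieltjesFunction

/-! ### Polarization of the matrix measure -/

namespace BandSpectral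

open MeasureTheory

namespace MatrixDistribution

variable {n : ℕ} (σ : MatrixDistribution n)

/-- Polarization of `v ↦ re (v* M v)`, which recovers the Hermitian part of `M`. -/
theorem polarization (M : Matrix (Fin n) (Fin n) ℂ) (i j : Fin n) :
    (1 / 4 : ℂ) * ∑ r ∈ Finset.range 4, (starRingEnd ℂ) (Complex.I ^ r) *
      (((star (Pi.single i 1 + Complex.I ^ r • Pi.single j 1 : Fin n → ℂ) ⬝ᵥ
        M.mulVec (Pi.single i 1 + Complex.I ^ r • Pi.single j 1)).re : ℝ) : ℂ) =
      (M i j + star (M j i)) / 2 := by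
  have h (w : ℂ) : star (Pi.single i 1 + w • Pi.single j 1 : Fin n → ℂ) ⬝ᵥ
        M.mulVec (Pi.single i 1 + w • Pi.single j 1) =
      M i i + w * M i j + star w * M j i + star w * w * M j j := by
    have hs (k : Fin n) : star (Pi.single k 1 : Fin n → ℂ) = Pi.single k 1 := by
      rw [← Pi.single_star, star_one]
    simp only [star_add, star_smul, hs, Matrix.mulVec_add, Matrix.mulVec_smul, add_dotProduct,
      dotProduct_add, smul_dotProduct, dotProduct_smul, single_one_dotProduct,
      Matrix.mulVec_single_one, smul_eq_mul, Matrix.col_apply]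
    ring
  simp only [h, Finset.sum_range_succ, Finset.sum_range_zero, Complex.I_sq, pow_zero, pow_one,
    Complex.I_pow_three]
  apply Complex.ext <;> simp <;> ring

theorem ofReal_quad (v : Fin n → ℂ) (t : ℝ) :
    (σ.quad v t : ℂ) = ∑ i, ∑ j, star (v i) * v j * ((1 / 4) * ∑ r ∈ Finset.range 4,
      (starRingEnd ℂ) (Complex.I ^ r) *
        (σ.quad (Pi.single i 1 + Complex.I ^ r • Pi.single j 1) t : ℂ)) := by
  simp only [quad, polarization]
  have h1 : star v ⬝ᵥ (σ.toFun t).mulVec v = ∑ i, ∑ j, star (v i) * v j * σ.toFun t i j := by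
    simp only [dotProduct, Matrix.mulVec, Finset.mul_sum, Pi.star_apply]
    exact Finset.sum_congr rfl fun i _ => Finset.sum_congr rfl fun j _ => by ring
  have h2 : star (star v ⬝ᵥ (σ.toFun t).mulVec v) =
      ∑ i, ∑ j, star (v i) * v j * star (σ.toFun t j i) := by
    rw [h1, star_sum, Finset.sum_comm]
    simp only [star_sum, star_mul, star_star]
    exact Finset.sum_congr rfl fun i _ => Finset.sum_congr rfl fun j _ => by ring
  rw [Complex.re_eq_add_conj, show (starRingEnd ℂ) (star v ⬝ᵥ (σ.toFun t).mulVec v) = _ from h2, h1]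
  simp only [← Finset.sum_add_distrib, Finset.sum_div]
  exact Finset.sum_congr rfl fun i _ => Finset.sum_congr rfl fun j _ => by ring

theorem tendsto_quad (v : Fin n → ℂ) (t : ℝ) :
    Filter.Tendsto (fun s => (σ.quad v s : ℂ)) (nhdsWithin t (Set.Ioi t))
      (nhds ((σ.quad_mono v).stieltjesFunction t : ℂ)) := by
  rw [Monotone.stieltjesFunction_eq]
  exact (Complex.continuous_ofReal.tendsto _).comp ((σ.quad_mono v).tendsto_rightLim t)

/-- The right limits that define the Stieltjes functions preserve the polarization identity. -/
theorem ofReal_stieltjes (v : Fin n → ℂ) (t : ℝ) :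
    ((σ.quad_mono v).stieltjesFunction t : ℂ) =
      ∑ i, ∑ j, star (v i) * v j * ((1 / 4) * ∑ r ∈ Finset.range 4,
        (starRingEnd ℂ) (Complex.I ^ r) *
        ((σ.quad_mono (Pi.single i 1 + Complex.I ^ r • Pi.single j 1)).stieltjesFunction t : ℂ)) := by
  refine tendsto_nhds_unique (σ.tendsto_quad v t) ?_
  simp only [σ.ofReal_quad v]
  exact tendsto_finsetSum _ fun i _ => tendsto_finsetSum _ fun j _ =>
    (((tendsto_finsetSum _ fun r _ => (σ.tendsto_quad _ t).const_mul _).const_mul _).const_mul _)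

/-- The integral with respect to the scalar measure of `v* σ v` in terms of the entries of `σ`. -/
theorem integral_quadMeasure (v : Fin n → ℂ) {f : ℝ → ℂ}
    (hf : ∀ w, Integrable f (σ.quadMeasure w)) :
    ∫ t, f t ∂(σ.quadMeasure v) = ∑ i, ∑ j, star (v i) * v j * σ.entryIntegral i j f := by
  have h := StieltjesFunction.sum_mul_integral_eq_zero
    (Finset.univ : Finset (Option (Fin n × Fin n × Fin 4)))
    (fun x => x.elim (-1) fun y => star (v y.1) * v y.2.1 * ((1 / 4) *
      (starRingEnd ℂ) (Complex.I ^ (y.2.2 : ℕ))))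
    (fun x => x.elim (σ.quad_mono v).stieltjesFunction fun y =>
      (σ.quad_mono (Pi.single y.1 1 +
        Complex.I ^ (y.2.2 : ℕ) • Pi.single y.2.1 1)).stieltjesFunction) ?_ (f := f) ?_
  · rw [Fintype.sum_option] at h
    simp only [Option.elim, Fintype.sum_prod_type] at h
    rw [neg_one_mul, neg_add_eq_zero] at h
    refine h.trans (Finset.sum_congr rfl fun i _ => Finset.sum_congr rfl fun j _ => ?_)
    rw [entryIntegral, Finset.sum_range, Finset.mul_sum, Finset.mul_sum]
    exact Finset.sum_congr rfl fun r _ => by simp only [quadMeasure, mul_assoc]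
  · intro t
    rw [Fintype.sum_option]
    simp only [Option.elim, Fintype.sum_prod_type]
    rw [neg_one_mul, neg_add_eq_zero, σ.ofReal_stieltjes v t]
    refine Finset.sum_congr rfl fun i _ => Finset.sum_congr rfl fun j _ => ?_
    rw [Finset.sum_range, Finset.mul_sum, Finset.mul_sum]
    exact Finset.sum_congr rfl fun r _ => by simp only [mul_assoc]
  · rintro (_ | y) -
    · exact hf v
    · exact hf _

end MatrixDistribution

end BandSpectral

/-! ### The inner product of `L_2(ℝ, σ)` on vector polynomials -/

namespace BandSpectral

open MeasureTheory

namespace MatrixDistribution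

variable {n : ℕ} {σ : MatrixDistribution n}

theorem FiniteMoments.isFiniteMeasure (h : σ.FiniteMoments) (v : Fin n → ℂ) :
    IsFiniteMeasure (σ.quadMeasure v) := by
  have := h v 0
  simp only [pow_zero] at this
  rwa [integrable_const_iff_isFiniteMeasure one_ne_zero] at this

theorem FiniteMoments.integrable_eval (h : σ.FiniteMoments) (p : ℂ[X]) (v : Fin n → ℂ) :
    Integrable (fun t : ℝ => p.eval (t : ℂ)) (σ.quadMeasure v) := by
  simp only [eval_eq_sum_range]
  refine integrable_finsetSum _ fun k _ => Integrable.const_mul ?_ _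
  simpa using (h v k).ofReal (𝕜 := ℂ)

theorem entryIntegral_const_mul (i j : Fin n) (c : ℂ) (f : ℝ → ℂ) :
    σ.entryIntegral i j (fun t => c * f t) = c * σ.entryIntegral i j f := by
  simp only [entryIntegral, integral_const_mul, Finset.mul_sum]
  exact Finset.sum_congr rfl fun r _ => by ring

theorem entryIntegral_sum {ι : Type*} (i j : Fin n) (s : Finset ι) (f : ι → ℝ → ℂ)
    (hf : ∀ k ∈ s, ∀ w, Integrable (f k) (σ.quadMeasure w)) :
    σ.entryIntegral i j (fun t => ∑ k ∈ s, f k t) = ∑ k ∈ s, σ.entryIntegral i j (f k) := by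
  simp only [entryIntegral]
  rw [← Finset.mul_sum, Finset.sum_comm]
  congr 1
  refine Finset.sum_congr rfl fun r _ => ?_
  rw [integral_finsetSum _ fun k hk => hf k hk _, Finset.mul_sum]

/-- Integration of polynomials with respect to the `(i,j)` entry of `σ`, as a linear functional. -/
noncomputable def entryFunctional (h : σ.FiniteMoments) (i j : Fin n) : ℂ[X] →ₗ[ℂ] ℂ where
  toFun p := σ.entryIntegral i j fun t => p.eval (t : ℂ)
  map_add' p q := by
    have := entryIntegral_sum (σ := σ) i j Finset.univ (fun b : Bool => fun t : ℝ =>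
      (bif b then p else q).eval (t : ℂ)) fun k _ w => h.integrable_eval _ w
    simpa using this
  map_smul' c p := by
    simpa using entryIntegral_const_mul i j c fun t => p.eval (t : ℂ)

/-- Complex conjugation of the coefficients of a polynomial. -/
noncomputable abbrev conjPoly (p : ℂ[X]) : ℂ[X] := p.map (starRingEnd ℂ)

theorem conj_eval_ofReal (p : ℂ[X]) (t : ℝ) :
    (starRingEnd ℂ) (p.eval (t : ℂ)) = (conjPoly p).eval (t : ℂ) := by
  rw [← eval_map_apply, Complex.conj_ofReal]

theorem inner_eq_entryFunctional (h : σ.FiniteMoments) (r s : Fin n → ℂ[X]) :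
    σ.inner r s = ∑ i, ∑ j, entryFunctional h i j (conjPoly (r i) * s j) := by
  refine Finset.sum_congr rfl fun i _ => Finset.sum_congr rfl fun j _ => ?_
  simp only [entryFunctional, LinearMap.coe_mk, AddHom.coe_mk, eval_mul, conj_eval_ofReal]

theorem inner_add_left (h : σ.FiniteMoments) (r r' s : Fin n → ℂ[X]) :
    σ.inner (r + r') s = σ.inner r s + σ.inner r' s := by
  simp only [inner_eq_entryFunctional h, ← Finset.sum_add_distrib, ← map_add, ← add_mul,
    ← Polynomial.map_add, Pi.add_apply]

theorem inner_add_right (h : σ.FiniteMoments) (r s s' : Fin n → ℂ[X]) :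
    σ.inner r (s + s') = σ.inner r s + σ.inner r s' := by
  simp only [inner_eq_entryFunctional h, ← Finset.sum_add_distrib, ← map_add, ← mul_add,
    Pi.add_apply]

theorem inner_smul_left (h : σ.FiniteMoments) (c : ℂ) (r s : Fin n → ℂ[X]) :
    σ.inner (c • r) s = (starRingEnd ℂ) c * σ.inner r s := by
  simp only [inner_eq_entryFunctional h, Pi.smul_apply, conjPoly, Polynomial.map_smul,
    smul_mul_assoc, map_smul, smul_eq_mul, Finset.mul_sum]

theorem inner_smul_right (h : σ.FiniteMoments) (c : ℂ) (r s : Fin n → ℂ[X]) :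
    σ.inner r (c • s) = c * σ.inner r s := by
  simp only [inner_eq_entryFunctional h, Pi.smul_apply, mul_smul_comm, map_smul, smul_eq_mul,
    Finset.mul_sum]

/-- Multiplication by a polynomial has as its adjoint the multiplication by the conjugate
polynomial, since `σ` lives on the real line. -/
theorem inner_poly_smul_left (h : σ.FiniteMoments) (f : ℂ[X]) (r s : Fin n → ℂ[X]) :
    σ.inner (f • r) s = σ.inner r (conjPoly f • s) := by
  simp only [inner_eq_entryFunctional h, Pi.smul_apply, smul_eq_mul, conjPoly, Polynomial.map_mul]
  simp only [mul_left_comm, mul_assoc]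

/-- On a level set with value `x` the form is the mass of the level set under the measure of
`x* σ x`. -/
theorem sum_entryIntegral_simpleFunc_nonneg (h : σ.FiniteMoments)
    (F : SimpleFunc ℝ (Fin n → ℂ)) :
    0 ≤ ∑ i, ∑ j, σ.entryIntegral i j fun t => (starRingEnd ℂ) (F t i) * F t j := by
  have hfin := h.isFiniteMeasure
  have hint (x : Fin n → ℂ) (w : Fin n → ℂ) :
      Integrable ((F ⁻¹' {x}).indicator fun _ => (1 : ℂ)) (σ.quadMeasure w) := by
    have := hfin w
    exact (integrable_const _).indicator (F.measurableSet_fiber x)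
  have hF (i j : Fin n) (t : ℝ) : (starRingEnd ℂ) (F t i) * F t j =
      ∑ x ∈ F.range, star (x i) * x j * (F ⁻¹' {x}).indicator (fun _ => (1 : ℂ)) t := by
    rw [Finset.sum_eq_single (F t)]
    · simp
    · intro x _ hx
      rw [Set.indicator_of_notMem, mul_zero]
      exact fun h => hx (Set.mem_singleton_iff.mp h).symm
    · exact fun h => absurd (F.mem_range_self t) h
  have hE (i j : Fin n) : (σ.entryIntegral i j fun t => (starRingEnd ℂ) (F t i) * F t j) =
      ∑ x ∈ F.range, star (x i) * x j *
        σ.entryIntegral i j ((F ⁻¹' {x}).indicator fun _ => (1 : ℂ)) := by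
    simp only [hF]
    rw [entryIntegral_sum i j _ _ fun x _ w => (hint x w).const_mul _]
    simp only [entryIntegral_const_mul]
  have hsum : (∑ i, ∑ j, σ.entryIntegral i j fun t => (starRingEnd ℂ) (F t i) * F t j) =
      ∑ x ∈ F.range, ∫ t, (F ⁻¹' {x}).indicator (fun _ => (1 : ℂ)) t ∂(σ.quadMeasure x) := by
    simp only [hE, σ.integral_quadMeasure _ (hint _)]
    rw [Finset.sum_comm (s := F.range)]
    exact Finset.sum_congr rfl fun i _ => Finset.sum_comm
  rw [hsum]
  refine Finset.sum_nonneg fun x _ => ?_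
  rw [integral_indicator (F.measurableSet_fiber x), integral_const]
  simp

/-- Simple functions that approximate `r` pointwise and are dominated by `2 ‖r‖` reduce this to
`sum_entryIntegral_simpleFunc_nonneg`. -/
theorem inner_self_nonneg (h : σ.FiniteMoments) (r : Fin n → ℂ[X]) : 0 ≤ σ.inner r r := by
  set R : ℝ → Fin n → ℂ := fun t i => (r i).eval (t : ℂ) with hR
  have hmeas : Measurable R := by
    refine Continuous.measurable (continuous_pi fun i => ?_)
    exact (r i).continuous.comp Complex.continuous_ofReal
  let F := SimpleFunc.approxOn R hmeas Set.univ 0 (Set.mem_univ 0)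
  have hlim (t : ℝ) : Filter.Tendsto (fun N => F N t) Filter.atTop (nhds (R t)) :=
    SimpleFunc.tendsto_approxOn hmeas _ (by simp)
  have hnorm (N : ℕ) (t : ℝ) : ‖F N t‖ ≤ ‖R t‖ + ‖R t‖ :=
    SimpleFunc.norm_approxOn_zero_le hmeas (Set.mem_univ 0) t N
  have hbound (w : Fin n → ℂ) : Integrable (fun t => 4 * ∑ i, ‖R t i‖ ^ 2) (σ.quadMeasure w) := by
    refine (integrable_finsetSum _ fun i _ => ?_).const_mul _
    have := (h.integrable_eval (conjPoly (r i) * r i) w).norm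
    simpa [← conj_eval_ofReal, hR, sq] using this
  have hle (N : ℕ) (i j : Fin n) (t : ℝ) :
      ‖(starRingEnd ℂ) (F N t i) * F N t j‖ ≤ 4 * ∑ i, ‖R t i‖ ^ 2 := by
    have h1 : ‖R t‖ ^ 2 ≤ ∑ i, ‖R t i‖ ^ 2 := by
      rw [← Real.le_sqrt (norm_nonneg _) (by positivity),
        pi_norm_le_iff_of_nonneg (Real.sqrt_nonneg _)]
      intro k
      rw [Real.le_sqrt (norm_nonneg _) (by positivity)]
      exact Finset.single_le_sum (f := fun i => ‖R t i‖ ^ 2) (fun i _ => by positivity)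
        (Finset.mem_univ k)
    have h2 := (norm_le_pi_norm (F N t) i).trans (hnorm N t)
    have h3 := (norm_le_pi_norm (F N t) j).trans (hnorm N t)
    rw [norm_mul, RCLike.norm_conj]
    calc _ ≤ (‖R t‖ + ‖R t‖) * (‖R t‖ + ‖R t‖) := by gcongr
      _ = 4 * ‖R t‖ ^ 2 := by ring
      _ ≤ _ := by gcongr
  refine ge_of_tendsto' (f := fun N => ∑ i, ∑ j, σ.entryIntegral i j
    fun t => (starRingEnd ℂ) (F N t i) * F N t j) (x := Filter.atTop) ?_
    fun N => sum_entryIntegral_simpleFunc_nonneg h (F N)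
  refine tendsto_finsetSum _ fun i _ => tendsto_finsetSum _ fun j _ => ?_
  refine Filter.Tendsto.const_mul _ (tendsto_finsetSum _ fun q _ => Filter.Tendsto.const_mul _ ?_)
  refine tendsto_integral_of_dominated_convergence (fun t => 4 * ∑ i, ‖R t i‖ ^ 2) ?_ (hbound _) ?_ ?_
  · intro N
    have := (F N).measurable
    exact Measurable.aestronglyMeasurable (by fun_prop)
  · exact fun N => Filter.Eventually.of_forall (hle N i j)
  · refine Filter.Eventually.of_forall fun t => ?_
    have hi (i : Fin n) := tendsto_pi_nhds.mp (hlim t) i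
    exact ((Complex.continuous_conj.tendsto _).comp (hi i)).mul (hi j)

theorem inner_conj_symm (h : σ.FiniteMoments) (r s : Fin n → ℂ[X]) :
    (starRingEnd ℂ) (σ.inner s r) = σ.inner r s := by
  -- A sesquilinear form whose quadratic form is real is Hermitian.
  have h0 (r : Fin n → ℂ[X]) : (σ.inner r r).im = 0 :=
    (Complex.nonneg_iff.mp (inner_self_nonneg h r)).2.symm
  have h1 := h0 (r + s)
  have h2 := h0 (r + Complex.I • s)
  simp only [inner_add_left h, inner_add_right h, inner_smul_left h, inner_smul_right h,
    Complex.add_im, h0, Complex.mul_im, Complex.mul_re, Complex.conj_I, Complex.neg_im,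
    Complex.neg_re, Complex.I_re, Complex.I_im] at h1 h2
  apply Complex.ext
  · simp only [Complex.conj_re]; linarith
  · simp only [Complex.conj_im]; linarith

/-- The inner product of `L_2(ℝ, σ)` as a positive semidefinite form on vector polynomials. -/
noncomputable abbrev innerCore (h : σ.FiniteMoments) :
    PreInnerProductSpace.Core ℂ (Fin n → ℂ[X]) where
  inner := σ.inner
  conj_inner_symm r s := inner_conj_symm h r s
  re_inner_nonneg r := (Complex.nonneg_iff.mp (inner_self_nonneg h r)).1
  add_left := inner_add_left h
  smul_left r s c := inner_smul_left h c r s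

theorem inner_eq_zero_of_inner_self_left (h : σ.FiniteMoments) {r : Fin n → ℂ[X]}
    (hr : σ.inner r r = 0) (s : Fin n → ℂ[X]) : σ.inner r s = 0 := by
  have hcs := @InnerProductSpace.Core.inner_mul_inner_self_le ℂ _ _ _ _ (innerCore h) r s
  change ‖σ.inner r s‖ * ‖σ.inner s r‖ ≤ (σ.inner r r).re * (σ.inner s s).re at hcs
  rw [← inner_conj_symm h s r, RCLike.norm_conj, hr, Complex.zero_re, zero_mul] at hcs
  exact norm_eq_zero.mp (mul_self_eq_zero.mp (le_antisymm hcs (mul_self_nonneg _)))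

theorem inner_eq_zero_of_inner_self_right (h : σ.FiniteMoments) {s : Fin n → ℂ[X]}
    (hs : σ.inner s s = 0) (r : Fin n → ℂ[X]) : σ.inner r s = 0 := by
  rw [← inner_conj_symm h, inner_eq_zero_of_inner_self_left h hs, map_zero]

theorem ofReal_normSq (h : σ.FiniteMoments) (r : Fin n → ℂ[X]) :
    (σ.normSq r : ℂ) = σ.inner r r :=
  Complex.ext rfl (Complex.nonneg_iff.mp (inner_self_nonneg h r)).2

theorem normSq_nonneg (h : σ.FiniteMoments) (r : Fin n → ℂ[X]) : 0 ≤ σ.normSq r :=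
  (Complex.nonneg_iff.mp (inner_self_nonneg h r)).1

theorem normSq_eq_zero (h : σ.FiniteMoments) {r : Fin n → ℂ[X]} :
    σ.normSq r = 0 ↔ σ.inner r r = 0 := by
  rw [← ofReal_normSq h, Complex.ofReal_eq_zero]

/-- The vector polynomials in the zero class of `L_2(ℝ, σ)`; by the Cauchy-Schwarz inequality they
form a module over the scalar polynomials. -/
noncomputable def nullSubmodule (h : σ.FiniteMoments) : Submodule ℂ[X] (Fin n → ℂ[X]) where
  carrier := {r | σ.inner r r = 0}
  add_mem' {r s} hr hs := by
    simp only [Set.mem_ofPred_eq] at hr hs ⊢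
    rw [inner_add_left h, inner_eq_zero_of_inner_self_left h hr,
      inner_eq_zero_of_inner_self_left h hs, add_zero]
  zero_mem' := by
    simp only [Set.mem_ofPred_eq]
    simpa using inner_smul_left h 0 0 (0 : Fin n → ℂ[X])
  smul_mem' f r hr := by
    simp only [Set.mem_ofPred_eq] at hr ⊢
    rw [inner_poly_smul_left h, inner_eq_zero_of_inner_self_left h hr]

theorem mem_nullSubmodule (h : σ.FiniteMoments) {r : Fin n → ℂ[X]} :
    r ∈ nullSubmodule h ↔ σ.inner r r = 0 := Iff.rfl

theorem inner_congr_right (h : σ.FiniteMoments) {s s' : Fin n → ℂ[X]}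
    (hs : s - s' ∈ nullSubmodule h) (r : Fin n → ℂ[X]) : σ.inner r s = σ.inner r s' := by
  rw [← sub_add_cancel s s', inner_add_right h, inner_eq_zero_of_inner_self_right h hs, zero_add]

theorem inner_congr_left (h : σ.FiniteMoments) {r r' : Fin n → ℂ[X]}
    (hr : r - r' ∈ nullSubmodule h) (s : Fin n → ℂ[X]) : σ.inner r s = σ.inner r' s := by
  rw [← sub_add_cancel r r', inner_add_left h, inner_eq_zero_of_inner_self_left h hr, zero_add]

/-- The linear functional `s ↦ ⟨r, s⟩`. -/
noncomputable def innerRight (h : σ.FiniteMoments) (r : Fin n → ℂ[X]) :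
    (Fin n → ℂ[X]) →ₗ[ℂ] ℂ where
  toFun := σ.inner r
  map_add' := inner_add_right h r
  map_smul' c s := by simpa using inner_smul_right h c r s

end MatrixDistribution

end BandSpectral

/-! ### Null vectors, the zeroth moment and growth points -/

namespace BandSpectral

open MeasureTheory

namespace MatrixDistribution

variable {n : ℕ} {σ : MatrixDistribution n}

theorem entryFunctional_X_pow (h : σ.FiniteMoments) (i j : Fin n) (k : ℕ) :
    entryFunctional h i j (X ^ k) = σ.moment k i j := by
  simp [entryFunctional, moment]

theorem inner_single_single (h : σ.FiniteMoments) (i j : Fin n) (f g : ℂ[X]) :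
    σ.inner (Pi.single i f) (Pi.single j g) = entryFunctional h i j (conjPoly f * g) := by
  rw [inner_eq_entryFunctional h, Finset.sum_eq_single i, Finset.sum_eq_single j]
  · simp
  · intro j' _ hj
    simp [Pi.single_eq_of_ne hj]
  · simp
  · intro i' _ hi
    simp [Pi.single_eq_of_ne hi]
  · simp

theorem inner_single_const (h : σ.FiniteMoments) (i : Fin n) (v : Fin n → ℂ) :
    σ.inner (Pi.single i 1) (fun j => C (v j)) = (σ.moment 0).mulVec v i := by
  have hv : (fun j => C (v j)) = ∑ j, v j • (Pi.single j 1 : Fin n → ℂ[X]) := by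
    ext1 j
    simp [Pi.single_apply, smul_eq_C_mul]
  change innerRight h _ _ = _
  rw [hv, map_sum]
  refine Finset.sum_congr rfl fun j _ => ?_
  rw [map_smul]
  change _ * σ.inner _ _ = _
  rw [inner_single_single h, conjPoly, Polynomial.map_one, one_mul, ← pow_zero X,
    entryFunctional_X_pow, mul_comm]

/-- A constant null vector lies in the kernel of `S_0`. -/
theorem const_eq_zero_of_null (h : σ.FiniteMoments) (h0 : IsUnit (σ.moment 0)) {v : Fin n → ℂ}
    (hv : (fun j => C (v j)) ∈ nullSubmodule h) : v = 0 := by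
  refine Matrix.mulVec_injective_of_isUnit h0 ?_
  ext i
  rw [← inner_single_const h, inner_eq_zero_of_inner_self_right h hv, Matrix.mulVec_zero,
    Pi.zero_apply]

theorem quadMeasure_support_of_null (h : σ.FiniteMoments) {i : Fin n} {f : ℂ[X]}
    (hf : (Pi.single i f : Fin n → ℂ[X]) ∈ nullSubmodule h) :
    σ.quadMeasure (Pi.single i 1) {t : ℝ | f.eval (t : ℂ) ≠ 0} = 0 := by
  have h1 : ∫ t : ℝ, (conjPoly f * f).eval (t : ℂ) ∂(σ.quadMeasure (Pi.single i 1)) = 0 := by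
    rw [σ.integral_quadMeasure _ fun w => h.integrable_eval _ w, Finset.sum_eq_single i,
      Finset.sum_eq_single i]
    · have := inner_single_single h i i f f
      rw [hf] at this
      rw [Pi.single_eq_same, star_one, one_mul, one_mul]
      exact this.symm
    · intro j _ hj
      simp [Pi.single_eq_of_ne hj]
    · simp
    · intro j _ hj
      simp [Pi.single_eq_of_ne hj]
    · simp
  have h2 (t : ℝ) : (conjPoly f * f).eval (t : ℂ) = ((‖f.eval (t : ℂ)‖ ^ 2 : ℝ) : ℂ) := by
    rw [eval_mul, ← conj_eval_ofReal, Complex.conj_mul']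
    push_cast
    rfl
  have h3 := (h.integrable_eval (conjPoly f * f) (Pi.single i 1)).re
  simp only [h2] at h1 h3
  rw [integral_complex_ofReal, Complex.ofReal_eq_zero, integral_eq_zero_iff_of_nonneg] at h1
  · have h4 := ae_iff.mp h1
    convert h4 using 3
    simp
  · intro t
    positivity
  · exact h3

/-- An increment of `σ` whose diagonal is not positive vanishes, because it is positive semidefinite
with trace zero. -/
theorem toFun_eq_of_quad_le {s t : ℝ} (hst : s ≤ t)
    (hq : ∀ i, σ.quad (Pi.single i 1) t ≤ σ.quad (Pi.single i 1) s) : σ.toFun t = σ.toFun s := by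
  have hp := σ.mono' hst
  rw [← sub_eq_zero, ← hp.trace_eq_zero_iff]
  refine Finset.sum_eq_zero fun i _ => ?_
  have hd := hp.diag_nonneg (i := i)
  have hs : star (Pi.single i 1 : Fin n → ℂ) = Pi.single i 1 := by
    rw [← Pi.single_star, star_one]
  have := hq i
  simp only [quad, hs, single_one_dotProduct, Matrix.mulVec_single_one, Matrix.col_apply] at this
  rw [Complex.nonneg_iff] at hd
  refine Complex.ext (le_antisymm ?_ hd.1) hd.2.symm
  simpa using this

/-- If every unit vector has a nonzero scalar multiple in the zero class then all growth points are
among finitely many zeros of polynomials. -/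
theorem exists_single_not_null (hσ : σ.InClass) (f : Fin n → ℂ[X]) (hf : ∀ i, f i ≠ 0) :
    ∃ i, (Pi.single i (f i) : Fin n → ℂ[X]) ∉ nullSubmodule hσ.finite_moments := by
  by_contra! hnull
  have hfin : (⋃ i, {t : ℝ | (f i).eval (t : ℂ) = 0}).Finite := by
    refine Set.finite_iUnion fun i => ?_
    refine Set.Finite.of_injOn (f := fun t : ℝ => (t : ℂ)) (t := {z | (f i).IsRoot z})
      (fun t ht => ht) (Complex.ofReal_injective.injOn) (finite_setOfPred_isRoot (hf i))
  obtain ⟨t, ht, htF⟩ := (hσ.infinite_growth.sdiff hfin).nonempty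
  obtain ⟨ε, hε, hball⟩ := Metric.isOpen_iff.mp hfin.isClosed.isOpen_compl t htF
  refine ht (ε / 4) (by positivity) (toFun_eq_of_quad_le (by linarith) fun i => ?_)
  have hm := quadMeasure_support_of_null hσ.finite_moments (hnull i)
  have hm' : σ.quadMeasure (Pi.single i 1) (Set.Ioc (t - ε / 2) (t + ε / 2)) = 0 := by
    refine measure_mono_null (fun s hs => ?_) hm
    have hs' : s ∈ Metric.ball t ε := by
      rw [Metric.mem_ball, Real.dist_eq, abs_lt]
      constructor <;> linarith [hs.1, hs.2]
    exact fun h0 => hball hs' (Set.mem_iUnion.mpr ⟨i, h0⟩)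
  rw [quadMeasure, StieltjesFunction.measure_Ioc, ENNReal.ofReal_eq_zero, sub_nonpos,
    Monotone.stieltjesFunction_eq, Monotone.stieltjesFunction_eq] at hm'
  have hmono := σ.quad_mono (Pi.single i 1)
  calc σ.quad (Pi.single i 1) (t + ε / 4) ≤ σ.quad (Pi.single i 1) (t + ε / 2) :=
        hmono (by linarith)
    _ ≤ _ := hmono.le_rightLim le_rfl
    _ ≤ _ := hm'
    _ ≤ _ := hmono.rightLim_le (by linarith)

end MatrixDistribution

open MatrixDistribution

/-! ### The Gram-Schmidt procedure -/

section GramSchmidt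

variable {n : ℕ} [NeZero n]

theorem X_smul_canon (k : ℕ) : (X : ℂ[X]) • canon n k = canon n (k + n) := by
  have hn : 0 < n := Nat.pos_of_ne_zero (NeZero.ne n)
  rw [canon, canon, ← Pi.single_smul, Nat.add_div_right k hn, smul_eq_mul, ← pow_succ']
  congr 1
  ext
  simp [Fin.ofNat]

theorem X_pow_smul_canon (l k : ℕ) : (X : ℂ[X]) ^ l • canon n k = canon n (k + n * l) := by
  induction l with
  | zero => simp
  | succ l ih => rw [pow_succ', mul_smul, ih, X_smul_canon, mul_add, mul_one, add_assoc]

theorem canon_of_lt (k : ℕ) (hk : k < n) : canon n k = Pi.single ⟨k, hk⟩ 1 := by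
  rw [canon, Nat.div_eq_of_lt hk, pow_zero]
  congr 1
  ext
  simp [Fin.ofNat, Nat.mod_eq_of_lt hk]

theorem span_canon : Submodule.span ℂ (Set.range (canon n)) = ⊤ := by
  have key (d : ℕ) (i : Fin n) : (Pi.single i (X ^ d) : Fin n → ℂ[X]) = canon n (i + n * d) := by
    rw [← X_pow_smul_canon, canon_of_lt i i.2, ← Pi.single_smul, smul_eq_mul, mul_one]
  rw [eq_top_iff]
  intro r _
  rw [← Finset.univ_sum_single r]
  refine Submodule.sum_mem _ fun i _ => ?_
  have : (Pi.single i (r i) : Fin n → ℂ[X]) =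
      ∑ d ∈ (r i).support, (r i).coeff d • (Pi.single i (X ^ d) : Fin n → ℂ[X]) := by
    change LinearMap.single ℂ (fun _ => ℂ[X]) i (r i) =
      ∑ d ∈ (r i).support, (r i).coeff d • LinearMap.single ℂ (fun _ => ℂ[X]) i (X ^ d)
    simp only [← map_smul, ← map_sum, smul_eq_C_mul]
    rw [← (r i).as_sum_support_C_mul_X_pow]
  rw [this]
  refine Submodule.sum_mem _ fun d _ => Submodule.smul_mem _ _ (Submodule.subset_span ?_)
  exact ⟨_, (key d i).symm⟩

variable (n) in
/-- The vector polynomials of height less than `K`. -/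
noncomputable def lowSpan (K : ℕ) : Submodule ℂ (Fin n → ℂ[X]) :=
  Submodule.span ℂ (canon n '' Set.Iio K)

theorem canon_mem_lowSpan {k K : ℕ} (h : k < K) : canon n k ∈ lowSpan n K :=
  Submodule.subset_span ⟨k, h, rfl⟩

theorem lowSpan_mono {K L : ℕ} (h : K ≤ L) : lowSpan n K ≤ lowSpan n L :=
  Submodule.span_mono (Set.image_mono (Set.Iio_subset_Iio h))

theorem X_smul_mem_lowSpan {K : ℕ} {r : Fin n → ℂ[X]} (hr : r ∈ lowSpan n K) :
    (X : ℂ[X]) • r ∈ lowSpan n (K + n) := by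
  induction hr using Submodule.span_induction with
  | mem r hr =>
    obtain ⟨k, hk, rfl⟩ := hr
    rw [X_smul_canon]
    exact canon_mem_lowSpan (Nat.add_lt_add_right hk n)
  | zero => rw [smul_zero]; exact zero_mem _
  | add r s _ _ hr hs => rw [smul_add]; exact add_mem hr hs
  | smul c r _ hr => rw [smul_comm]; exact Submodule.smul_mem _ _ hr

theorem X_pow_smul_mem_lowSpan {K : ℕ} {r : Fin n → ℂ[X]} (hr : r ∈ lowSpan n K) (l : ℕ) :
    (X : ℂ[X]) ^ l • r ∈ lowSpan n (K + n * l) := by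
  induction l with
  | zero => simpa using hr
  | succ l ih => rw [pow_succ', mul_smul, mul_add, mul_one, ← add_assoc]; exact X_smul_mem_lowSpan ih

theorem exists_const_of_mem_lowSpan {K : ℕ} (hK : K ≤ n) {r : Fin n → ℂ[X]}
    (hr : r ∈ lowSpan n K) :
    ∃ v : Fin n → ℂ, r = (fun i => C (v i)) ∧ ∀ i : Fin n, K ≤ i → v i = 0 := by
  induction hr using Submodule.span_induction with
  | mem r hr =>
    obtain ⟨k, hk, rfl⟩ := hr
    have hkn : k < n := lt_of_lt_of_le hk hK
    refine ⟨Pi.single ⟨k, hkn⟩ 1, ?_, fun i hi => Pi.single_eq_of_ne ?_ _⟩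
    · rw [canon_of_lt k hkn]
      ext1 i
      simp [Pi.single_apply, apply_ite C]
    · rintro rfl
      exact absurd hi (not_le.mpr hk)
  | zero => exact ⟨0, by ext1; simp, by simp⟩
  | add r s _ _ hr hs =>
    obtain ⟨v, rfl, hv⟩ := hr
    obtain ⟨w, rfl, hw⟩ := hs
    exact ⟨v + w, by ext1; simp, fun i hi => by simp [hv i hi, hw i hi]⟩
  | smul c r _ hr =>
    obtain ⟨v, rfl, hv⟩ := hr
    exact ⟨c • v, by ext1; simp [smul_eq_C_mul], fun i hi => by simp [hv i hi]⟩

theorem gs_sub_canon_mem (σ : MatrixDistribution n) (k : ℕ) :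
    gs σ k - canon n k ∈ lowSpan n k := by
  induction k using Nat.strong_induction_on with
  | _ k ih =>
    rw [gs, sub_sub_cancel_left]
    refine neg_mem (Submodule.sum_mem _ fun i _ => Submodule.smul_mem _ _
      (Submodule.smul_mem _ _ ?_))
    rw [← sub_add_cancel (gs σ i) (canon n i)]
    exact add_mem (lowSpan_mono i.2.le (ih i i.2)) (canon_mem_lowSpan i.2)

theorem gs_mem_lowSpan (σ : MatrixDistribution n) {k K : ℕ} (h : k < K) :
    gs σ k ∈ lowSpan n K := by
  rw [← sub_add_cancel (gs σ k) (canon n k)]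
  exact add_mem (lowSpan_mono h.le (gs_sub_canon_mem σ k)) (canon_mem_lowSpan h)

/-- A subspace that contains `canon n k` as soon as it contains all vectors of smaller height
contains everything. -/
theorem eq_top_of_canon_mem {P : Submodule ℂ (Fin n → ℂ[X])}
    (hP : ∀ k, lowSpan n k ≤ P → canon n k ∈ P) : P = ⊤ := by
  have h (k : ℕ) : canon n k ∈ P := by
    induction k using Nat.strong_induction_on with
    | _ k ih =>
      refine hP k (Submodule.span_le.mpr ?_)
      rintro _ ⟨i, hi, rfl⟩
      exact ih i hi
  rw [eq_top_iff, ← span_canon]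
  exact Submodule.span_le.mpr (Set.range_subset_iff.mpr h)

theorem lowSpan_le_span_gs (σ : MatrixDistribution n) (K : ℕ) :
    lowSpan n K ≤ Submodule.span ℂ (gs σ '' Set.Iio K) := by
  induction K with
  | zero => simp [lowSpan]
  | succ K ih =>
    refine Submodule.span_le.mpr ?_
    have hmono := Submodule.span_mono (R := ℂ)
      (Set.image_mono (f := gs σ) (Set.Iio_subset_Iio (Nat.le_succ K)))
    rintro _ ⟨k, hk, rfl⟩
    rcases (Nat.lt_succ_iff_lt_or_eq.mp hk) with hk | rfl
    · exact hmono (ih (canon_mem_lowSpan hk))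
    · rw [← sub_sub_cancel (gs σ k) (canon n k)]
      exact sub_mem (Submodule.subset_span ⟨k, Nat.lt_succ_self k, rfl⟩)
        (hmono (ih (gs_sub_canon_mem σ k)))

variable {σ : MatrixDistribution n}

/-- Orthogonality also holds for outputs of zero norm: their components are not subtracted, but they
are orthogonal to everything. -/
theorem inner_gs_gs_of_lt (h : σ.FiniteMoments) {i k : ℕ} (hik : i < k) :
    σ.inner (gs σ i) (gs σ k) = 0 := by
  induction k using Nat.strong_induction_on generalizing i with
  | _ k ih =>
    have hz (l : Fin k) (hl : l ≠ ⟨i, hik⟩) : σ.inner (gs σ i) (gs σ l) = 0 := by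
      rcases lt_trichotomy i l with hlt | heq | hgt
      · exact ih l l.2 hlt
      · exact absurd (Fin.ext heq.symm) hl
      · rw [← inner_conj_symm h, ih i hik hgt, map_zero]
    rw [gs.eq_def σ k]
    change innerRight h _ _ = 0
    rw [map_sub, map_sum, Finset.sum_eq_single ⟨i, hik⟩]
    · simp only [map_smul]
      change σ.inner _ _ - σ.inner _ _ * (_ * σ.inner _ _) = 0
      rw [inner_smul_left h, Complex.conj_ofReal, ← ofReal_normSq h]
      by_cases h0 : σ.normSq (gs σ i) = 0
      · rw [inner_eq_zero_of_inner_self_left h ((normSq_eq_zero h).mp h0)]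
        simp
      · have hs : (((√(σ.normSq (gs σ i)))⁻¹ : ℝ) : ℂ) * (((√(σ.normSq (gs σ i)))⁻¹ : ℝ) : ℂ) *
            (σ.normSq (gs σ i) : ℂ) = 1 := by
          rw [← Complex.ofReal_mul, ← Complex.ofReal_mul, ← mul_inv,
            Real.mul_self_sqrt (normSq_nonneg h _), inv_mul_cancel₀ h0, Complex.ofReal_one]
        linear_combination (-σ.inner (gs σ i) (canon n k)) * hs
    · intro l _ hl
      simp only [map_smul]
      change _ * (_ * σ.inner _ _) = 0
      rw [hz l hl, mul_zero, mul_zero]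
    · simp

theorem inner_gs_of_mem_lowSpan (h : σ.FiniteMoments) {k : ℕ} {r : Fin n → ℂ[X]}
    (hr : r ∈ lowSpan n k) : σ.inner (gs σ k) r = 0 := by
  have hle : Submodule.span ℂ (gs σ '' Set.Iio k) ≤ LinearMap.ker (innerRight h (gs σ k)) := by
    refine Submodule.span_le.mpr ?_
    rintro _ ⟨i, hi, rfl⟩
    change σ.inner _ _ = 0
    rw [← inner_conj_symm h, inner_gs_gs_of_lt h hi, map_zero]
  exact hle (lowSpan_le_span_gs σ k hr)

/-- `gs (k + n)` differs from the null vector `z gs k` by a vector of smaller height, to which it is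
orthogonal. -/
theorem normSq_gs_add (h : σ.FiniteMoments) {k : ℕ} (hk : σ.normSq (gs σ k) = 0) :
    σ.normSq (gs σ (k + n)) = 0 := by
  rw [normSq_eq_zero h] at hk ⊢
  have hd : gs σ (k + n) - (X : ℂ[X]) • gs σ k ∈ lowSpan n (k + n) := by
    have h1 := gs_sub_canon_mem σ (k + n)
    have h2 := X_smul_mem_lowSpan (gs_sub_canon_mem σ k)
    rw [smul_sub, X_smul_canon] at h2
    convert sub_mem h1 h2 using 1
    abel
  have := inner_gs_of_mem_lowSpan h hd
  rwa [inner_congr_right h (s' := gs σ (k + n))] at this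
  rw [sub_sub_cancel_left]
  exact neg_mem (Submodule.smul_mem _ _ hk)

theorem normSq_gs_of_lt (h : σ.FiniteMoments) (h0 : IsUnit (σ.moment 0)) {k : ℕ} (hk : k < n) :
    σ.normSq (gs σ k) ≠ 0 := by
  rw [Ne, normSq_eq_zero h]
  intro hnull
  obtain ⟨v, hv, hv0⟩ := exists_const_of_mem_lowSpan hk.le (gs_sub_canon_mem σ k)
  have hg : gs σ k = fun i => C ((Pi.single ⟨k, hk⟩ 1 + v : Fin n → ℂ) i) := by
    rw [← sub_add_cancel (gs σ k) (canon n k), hv, canon_of_lt k hk]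
    ext1 i
    simp [Pi.single_apply, apply_ite C, add_comm]
  rw [hg, ← mem_nullSubmodule h] at hnull
  have := congrFun (const_eq_zero_of_null h h0 hnull) ⟨k, hk⟩
  simp [hv0 ⟨k, hk⟩ le_rfl] at this

/-- Vector polynomials orthogonal to all outputs of nonzero norm are null. -/
theorem mem_null_of_inner_gs (h : σ.FiniteMoments) {r : Fin n → ℂ[X]}
    (hr : ∀ k, σ.normSq (gs σ k) ≠ 0 → σ.inner (gs σ k) r = 0) : r ∈ nullSubmodule h := by
  have htop : LinearMap.ker (innerRight h r) = ⊤ := by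
    refine eq_top_of_canon_mem fun k hk => ?_
    rw [← sub_sub_cancel (gs σ k) (canon n k)]
    refine sub_mem ?_ (hk (gs_sub_canon_mem σ k))
    change σ.inner _ _ = 0
    by_cases h0 : σ.normSq (gs σ k) = 0
    · exact inner_eq_zero_of_inner_self_right h ((normSq_eq_zero h).mp h0) _
    · rw [← inner_conj_symm h, hr k h0, map_zero]
  have hr' : r ∈ LinearMap.ker (innerRight h r) := by
    rw [htop]
    exact Submodule.mem_top
  exact LinearMap.mem_ker.mp hr'

theorem infinite_normSq_gs_ne_zero (hσ : σ.InClass) :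
    {k | σ.normSq (gs σ k) ≠ 0}.Infinite := by
  have h := hσ.finite_moments
  intro hfin
  -- Finitely many orthogonality conditions cannot exclude all polynomial multiples of a unit vector.
  have hex (i : Fin n) : ∃ f : ℂ[X], f ≠ 0 ∧ (Pi.single i f : Fin n → ℂ[X]) ∈ nullSubmodule h := by
    have := hfin.to_subtype
    let φ : ℂ[X] →ₗ[ℂ] ({k | σ.normSq (gs σ k) ≠ 0} → ℂ) :=
      LinearMap.pi fun k => (innerRight h (gs σ k)).comp (LinearMap.single ℂ (fun _ => ℂ[X]) i)
    have hφ : ¬ Function.Injective φ := fun hinj =>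
      Polynomial.not_finite (Module.Finite.of_injective φ hinj)
    rw [← LinearMap.ker_eq_bot, ← Ne, Submodule.ne_bot_iff] at hφ
    obtain ⟨f, hf, hf0⟩ := hφ
    exact ⟨f, hf0, mem_null_of_inner_gs h fun k hk => congrFun hf ⟨k, hk⟩⟩
  choose f hf0 hf using hex
  obtain ⟨i, hi⟩ := exists_single_not_null hσ f hf0
  exact hi (hf i)

end GramSchmidt

end BandSpectral

namespace BandSpectral

/-! ### Counting the degeneration rows -/

section Counting

variable {S : ℕ → Prop} [DecidablePred S]

/-- For a set `S` of naturals that contains `0, …, n - 1` and whose complement is invariant under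
`s ↦ s + n`, the elements of `S` below `a + n` are counted by those below `a`, up to the number
of indices `i` at which the shift by `n` of the `i`th element of `S` leaves `S`. -/
theorem count_add_count_defect {n : ℕ} (hfirst : ∀ s < n, S s) (hshift : ∀ s, S (s + n) → S s)
    (a : ℕ) :
    Nat.count S (a + n) + Nat.count (fun i => ¬ S (Nat.nth S i + n)) (Nat.count S a) =
      Nat.count S a + n := by
  induction a with
  | zero =>
    rw [zero_add, Nat.count_zero, Nat.count_zero, add_zero, zero_add, Nat.count_iff_forall]
    exact hfirst
  | succ a ih =>
    rw [add_right_comm, Nat.count_succ, Nat.count_succ (p := S) (n := a)]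
    by_cases ha : S a
    · rw [if_pos ha, Nat.count_succ, Nat.nth_count ha]
      by_cases hb : S (a + n)
      · simp only [hb, if_true, not_true, if_false]
        omega
      · simp only [hb, if_false, not_false_iff, if_true]
        omega
    · rw [if_neg ha, if_neg fun hb => ha (hshift a hb)]
      omega

variable {D : ℕ → Prop} [DecidablePred D]

theorem finite_of_count_lt {n : ℕ} (h : ∀ k, Nat.count D k < n) : (Set.ofPred D).Finite := by
  by_contra hinf
  have := h (Nat.nth D n)
  rw [Nat.count_nth_of_infinite hinf] at this
  exact lt_irrefl _ this

theorem card_lt_of_count_lt {n : ℕ} (h : ∀ k, Nat.count D k < n) (hfin : (Set.ofPred D).Finite) :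
    hfin.toFinset.card < n := by
  by_contra! hle
  have hn : 0 < n := (Nat.zero_le _).trans_lt (h 0)
  have h1 : n - 1 < hfin.toFinset.card := by omega
  have h2 := h (Nat.nth D (n - 1) + 1)
  rw [Nat.count_succ, if_pos (Nat.nth_mem (n - 1) fun _ => h1), Nat.count_nth fun _ => h1] at h2
  omega

/-- A symmetric matrix whose column `k` ends with a positive entry at the row `k + n - #{i < k, D i}`
if `k` is not in `D`, and strictly above this row otherwise, is a degenerate band matrix with the
elements of `D` as its degeneration rows. -/
theorem isDegenerateBand_of_count {n : ℕ} {A : ℕ → ℕ → ℝ} (hD : ∀ k, Nat.count D k < n)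
    (hfin : (Set.ofPred D).Finite) (hsymm : ∀ k l, A k l = A l k)
    (hzero : ∀ i k, k + n < i + Nat.count D k → A i k = 0)
    (hzero' : ∀ i k, D k → i + Nat.count D k = k + n → A i k = 0)
    (hpos : ∀ i k, ¬ D k → i + Nat.count D k = k + n → 0 < A i k) :
    IsDegenerateBand n A hfin.toFinset.card fun j => Nat.nth D j := by
  have hmem (j : Fin hfin.toFinset.card) : D (Nat.nth D j) := Nat.nth_mem j fun _ => j.2
  have hcount (j : Fin hfin.toFinset.card) : Nat.count D (Nat.nth D j) = j :=
    Nat.count_nth fun _ => j.2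
  have hlt {j : Fin hfin.toFinset.card} {k : ℕ} (h : Nat.nth D j < k) : (j : ℕ) < Nat.count D k := by
    have := Nat.count_monotone D (Nat.succ_le_of_lt h)
    rw [Nat.succ_eq_add_one, Nat.count_succ, if_pos (hmem j), hcount] at this
    omega
  have hcard := card_lt_of_count_lt hD hfin
  have hmono : StrictMono fun j : Fin hfin.toFinset.card => Nat.nth D j := fun i j hij =>
    Nat.nth_lt_nth' hij fun _ => j.2
  refine ⟨hsymm, fun k l hkl => ?_, hcard, hmono, fun j k h1 h2 => ?_, fun j k hk => ?_,
    fun k hk => ?_⟩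
  · rw [hsymm]
    exact hzero l k (by omega)
  · have hle := Nat.count_monotone D h2.le
    rw [hcount] at hle
    have hj : Nat.count D k = j := by
      refine le_antisymm hle (not_lt.mp fun hc => ?_)
      exact lt_irrefl _ (hlt (h1 ⟨Nat.count D k, hc.trans j.2⟩ hc))
    refine hpos _ _ (fun hDk => ?_) (by omega)
    rw [← hj, Nat.nth_count hDk] at h2
    exact lt_irrefl _ h2
  · rcases eq_or_lt_of_le hk with rfl | hk
    · exact hzero' _ _ (hmem j) (by rw [hcount]; omega)
    · have := hlt hk
      exact hzero _ _ (by omega)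
  · have hj : Nat.count D k = hfin.toFinset.card := by
      refine le_antisymm ?_ (not_lt.mp fun hc => lt_irrefl _ (hlt (hk ⟨Nat.count D k, hc⟩)))
      rw [Nat.count_eq_card_filter_range]
      refine Finset.card_le_card fun i hi => ?_
      exact hfin.mem_toFinset.mpr (Finset.mem_filter.mp hi).2
    refine hpos _ _ (fun hDk => ?_) (by omega)
    have hc : Nat.count D k < hfin.toFinset.card := Nat.count_lt_card hfin hDk
    omega

end Counting

/-! ### Solving a degenerate band recurrence -/

section Recursion

variable {n : ℕ}

/-- The solution of the recurrence with initial values `init`, where the `l`th vector polynomial,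
`l ≥ n`, is computed from the row `row l`, in which it has the last nonzero coefficient. -/
noncomputable def bandSolution (A : ℕ → ℕ → ℝ) (row : ℕ → ℕ) (init : ℕ → Fin n → ℂ[X]) (l : ℕ) :
    Fin n → ℂ[X] :=
  if l < n then init l else
    ((A (row l) l : ℝ) : ℂ)⁻¹ • ∑ i : Fin l,
      ((if (i : ℕ) = row l then (X : ℂ[X]) • bandSolution A row init i else 0) -
        ((A (row l) i : ℝ) : ℂ) • bandSolution A row init i)
termination_by l
decreasing_by all_goals exact i.2

theorem bandSolution_of_lt {A : ℕ → ℕ → ℝ} {row : ℕ → ℕ} {init : ℕ → Fin n → ℂ[X]} {l : ℕ}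
    (hl : l < n) : bandSolution A row init l = init l := by
  rw [bandSolution, if_pos hl]

theorem sum_bandSolution {A : ℕ → ℕ → ℝ} {row : ℕ → ℕ} {init : ℕ → Fin n → ℂ[X]} {l : ℕ}
    (hl : n ≤ l) (hrow : row l < l) (hA : A (row l) l ≠ 0) :
    ∑ i ∈ Finset.range (l + 1), ((A (row l) i : ℝ) : ℂ) • bandSolution A row init i =
      (X : ℂ[X]) • bandSolution A row init (row l) := by
  have hA' : ((A (row l) l : ℝ) : ℂ) ≠ 0 := Complex.ofReal_ne_zero.mpr hA
  rw [Finset.sum_range_succ, bandSolution.eq_def A row init l, if_neg (not_lt.mpr hl),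
    smul_inv_smul₀ hA', Finset.sum_sub_distrib,
    Finset.sum_eq_single (⟨row l, hrow⟩ : Fin l), if_pos rfl,
    Fin.sum_univ_eq_sum_range (fun i => ((A (row l) i : ℝ) : ℂ) • bandSolution A row init i) l]
  · abel
  · intro i _ hi
    rw [if_neg fun h => hi (Fin.ext h)]
  · simp

end Recursion

end BandSpectral

namespace BandSpectral

open MatrixDistribution

/-! ### Real coefficients -/

section Real

variable {n : ℕ}

/-- The vector polynomials with real coefficients, described as those fixed by conjugation. -/
noncomputable def realVectors (n : ℕ) : AddSubgroup (Fin n → ℂ[X]) where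
  carrier := {r | ∀ i, (r i).map (starRingEnd ℂ) = r i}
  add_mem' hr hs i := by rw [Pi.add_apply, Polynomial.map_add, hr i, hs i]
  zero_mem' i := Polynomial.map_zero _
  neg_mem' hr i := by rw [Pi.neg_apply, Polynomial.map_neg, hr i]

theorem smul_mem_realVectors {c : ℂ} (hc : c.im = 0) {r : Fin n → ℂ[X]}
    (hr : r ∈ realVectors n) : c • r ∈ realVectors n := fun i => by
  rw [Pi.smul_apply, Polynomial.map_smul, hr i, Complex.conj_eq_iff_im.mpr hc]

theorem X_smul_mem_realVectors {r : Fin n → ℂ[X]} (hr : r ∈ realVectors n) :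
    (X : ℂ[X]) • r ∈ realVectors n := fun i => by
  rw [Pi.smul_apply, smul_eq_mul, Polynomial.map_mul, hr i, Polynomial.map_X]

theorem canon_mem_realVectors [NeZero n] (k : ℕ) : canon n k ∈ realVectors n := fun i => by
  rcases eq_or_ne i (Fin.ofNat n k) with rfl | hi
  · simp [canon]
  · rw [canon, Pi.single_eq_of_ne hi, Polynomial.map_zero]

variable {σ : MatrixDistribution n}

theorem inner_im_eq_zero (h : σ.FiniteMoments)
    (hreal : ∀ (k : ℕ) (i j : Fin n), (σ.moment k i j).im = 0) {r s : Fin n → ℂ[X]}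
    (hr : r ∈ realVectors n) (hs : s ∈ realVectors n) : (σ.inner r s).im = 0 := by
  have hE (i j : Fin n) (p : ℂ[X]) (hp : p.map (starRingEnd ℂ) = p) : (entryFunctional h i j p).im = 0 := by
    rw [p.as_sum_support_C_mul_X_pow, map_sum, Complex.im_sum]
    refine Finset.sum_eq_zero fun d _ => ?_
    have hc : (p.coeff d).im = 0 := by
      rw [← Complex.conj_eq_iff_im, ← coeff_map]
      exact congrArg (fun q => coeff q d) hp
    rw [← smul_eq_C_mul, map_smul, smul_eq_mul, entryFunctional_X_pow, Complex.mul_im, hc, hreal]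
    simp
  rw [inner_eq_entryFunctional h, Complex.im_sum]
  refine Finset.sum_eq_zero fun i _ => ?_
  rw [Complex.im_sum]
  refine Finset.sum_eq_zero fun j _ => hE _ _ _ ?_
  rw [conjPoly, hr i, Polynomial.map_mul, hr i, hs j]

variable [NeZero n]

theorem gs_mem_realVectors (h : σ.FiniteMoments)
    (hreal : ∀ (k : ℕ) (i j : Fin n), (σ.moment k i j).im = 0) (k : ℕ) :
    gs σ k ∈ realVectors n := by
  induction k using Nat.strong_induction_on with
  | _ k ih =>
    rw [gs]
    refine sub_mem (canon_mem_realVectors k) (sum_mem fun i _ => ?_)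
    have hi := smul_mem_realVectors (Complex.ofReal_im (√(σ.normSq (gs σ i)))⁻¹) (ih i i.2)
    exact smul_mem_realVectors (inner_im_eq_zero h hreal hi (canon_mem_realVectors k)) hi

theorem ptilde_mem_realVectors (h : σ.FiniteMoments)
    (hreal : ∀ (k : ℕ) (i j : Fin n), (σ.moment k i j).im = 0) (k : ℕ) :
    ptilde σ k ∈ realVectors n :=
  smul_mem_realVectors (Complex.ofReal_im _) (gs_mem_realVectors h hreal _)

end Real

/-! ### The matrix of multiplication by `z` -/

section Orthonormal

variable {n : ℕ} [NeZero n] (σ : MatrixDistribution n)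

/-- The step of the Gram-Schmidt procedure that produces the `k`th vector of nonzero norm. -/
noncomputable def height (k : ℕ) : ℕ := Nat.nth (fun i => σ.normSq (gs σ i) ≠ 0) k

/-- The number of vectors of nonzero norm produced before step `a`. -/
noncomputable def rankBelow (a : ℕ) : ℕ := Nat.count (fun i => σ.normSq (gs σ i) ≠ 0) a

/-- The row `k` is a degeneration row: multiplication by `z` takes the leading term of `ptilde k` to
a step at which the output of the Gram-Schmidt procedure has norm zero. -/
def IsDefect (k : ℕ) : Prop := ¬ σ.normSq (gs σ (height σ k + n)) ≠ 0

noncomputable instance : DecidablePred (IsDefect σ) :=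
  inferInstanceAs (DecidablePred fun k => ¬ σ.normSq (gs σ (height σ k + n)) ≠ 0)

/-- The factor that normalizes the `k`th output of nonzero norm. -/
noncomputable def normFactor (k : ℕ) : ℝ := (√(σ.normSq (gs σ (height σ k))))⁻¹

theorem ptilde_eq (k : ℕ) : ptilde σ k = (normFactor σ k : ℂ) • gs σ (height σ k) := rfl

variable {σ}

theorem normSq_gs_height_ne_zero (hσ : σ.InClass) (k : ℕ) : σ.normSq (gs σ (height σ k)) ≠ 0 :=
  Nat.nth_mem_of_infinite (infinite_normSq_gs_ne_zero hσ) k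

theorem normFactor_pos (hσ : σ.InClass) (k : ℕ) : 0 < normFactor σ k :=
  inv_pos.mpr (Real.sqrt_pos.mpr
    ((normSq_nonneg hσ.finite_moments _).lt_of_ne' (normSq_gs_height_ne_zero hσ k)))

theorem height_strictMono (hσ : σ.InClass) : StrictMono (height σ) :=
  Nat.nth_strictMono (infinite_normSq_gs_ne_zero hσ)

theorem rankBelow_height (hσ : σ.InClass) (k : ℕ) : rankBelow σ (height σ k) = k :=
  Nat.count_nth_of_infinite (infinite_normSq_gs_ne_zero hσ) k

theorem height_rankBelow {a : ℕ} (ha : σ.normSq (gs σ a) ≠ 0) : height σ (rankBelow σ a) = a :=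
  Nat.nth_count ha

theorem le_height (hσ : σ.InClass) {a k : ℕ} (h : rankBelow σ a ≤ k) : a ≤ height σ k :=
  (Nat.count_le_iff_le_nth (infinite_normSq_gs_ne_zero hσ)).mp h

theorem rankBelow_of_le (hσ : σ.InClass) {k : ℕ} (hk : k ≤ n) : rankBelow σ k = k :=
  Nat.count_iff_forall.mpr fun _ h =>
    normSq_gs_of_lt hσ.finite_moments hσ.isUnit_moment_zero (h.trans_le hk)

theorem height_of_lt (hσ : σ.InClass) {k : ℕ} (hk : k < n) : height σ k = k := by
  conv_lhs => rw [← rankBelow_of_le hσ hk.le]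
  exact height_rankBelow (normSq_gs_of_lt hσ.finite_moments hσ.isUnit_moment_zero hk)

theorem rankBelow_add_count (hσ : σ.InClass) (k : ℕ) :
    rankBelow σ (height σ k + n) + Nat.count (IsDefect σ) k = k + n := by
  have h := count_add_count_defect (S := fun i => σ.normSq (gs σ i) ≠ 0) (n := n)
    (fun s hs => normSq_gs_of_lt hσ.finite_moments hσ.isUnit_moment_zero hs)
    (fun s => mt (normSq_gs_add hσ.finite_moments)) (height σ k)
  rw [show Nat.count _ (height σ k) = k from rankBelow_height hσ k] at h
  exact h

theorem rankBelow_mono {a b : ℕ} (h : a ≤ b) : rankBelow σ a ≤ rankBelow σ b :=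
  Nat.count_monotone _ h

theorem lt_rankBelow (hσ : σ.InClass) {k a : ℕ} (h : height σ k < a) : k < rankBelow σ a :=
  (Nat.lt_nth_iff_count_lt (infinite_normSq_gs_ne_zero hσ)).mpr h

/-- The vector `ptilde k` itself is counted below `height k + n`. -/
theorem count_isDefect_lt (hσ : σ.InClass) (k : ℕ) : Nat.count (IsDefect σ) k < n := by
  have h1 := rankBelow_add_count hσ k
  have h2 := lt_rankBelow hσ (Nat.lt_add_of_pos_right (n := height σ k)
    (Nat.pos_of_ne_zero (NeZero.ne n)))
  omega

theorem inner_ptilde_ptilde (hσ : σ.InClass) (k l : ℕ) :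
    σ.inner (ptilde σ k) (ptilde σ l) = if k = l then 1 else 0 := by
  have h := hσ.finite_moments
  rw [ptilde_eq, ptilde_eq, inner_smul_left h, inner_smul_right h]
  split_ifs with hkl
  · subst hkl
    rw [← ofReal_normSq h, Complex.conj_ofReal, ← Complex.ofReal_mul, ← Complex.ofReal_mul,
      normFactor, ← mul_assoc, ← mul_inv, Real.mul_self_sqrt (normSq_nonneg h _),
      inv_mul_cancel₀ (normSq_gs_height_ne_zero hσ k), Complex.ofReal_one]
  · rcases lt_or_gt_of_ne hkl with hlt | hlt
    · rw [inner_gs_gs_of_lt h (height_strictMono hσ hlt), mul_zero, mul_zero]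
    · rw [← inner_conj_symm h, inner_gs_gs_of_lt h (height_strictMono hσ hlt), map_zero, mul_zero,
        mul_zero]

theorem inner_ptilde_of_mem_lowSpan (h : σ.FiniteMoments) {k : ℕ} {r : Fin n → ℂ[X]}
    (hr : r ∈ lowSpan n (height σ k)) : σ.inner (ptilde σ k) r = 0 := by
  rw [ptilde_eq, inner_smul_left h, inner_gs_of_mem_lowSpan h hr, mul_zero]

theorem X_smul_ptilde_sub_mem (σ : MatrixDistribution n) (k : ℕ) :
    (X : ℂ[X]) • ptilde σ k - (normFactor σ k : ℂ) • gs σ (height σ k + n) ∈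
      lowSpan n (height σ k + n) := by
  rw [ptilde_eq, smul_comm, ← smul_sub]
  refine Submodule.smul_mem _ _ ?_
  have h1 := gs_sub_canon_mem σ (height σ k + n)
  have h2 := X_smul_mem_lowSpan (gs_sub_canon_mem σ (height σ k))
  rw [smul_sub, X_smul_canon] at h2
  convert sub_mem h2 h1 using 1
  abel

/-- The matrix of multiplication by `z` with respect to the orthonormal sequence. -/
noncomputable def bandMatrix (σ : MatrixDistribution n) (i k : ℕ) : ℝ :=
  (σ.inner (ptilde σ i) ((X : ℂ[X]) • ptilde σ k)).re

theorem ofReal_bandMatrix (h : σ.FiniteMoments)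
    (hreal : ∀ (k : ℕ) (i j : Fin n), (σ.moment k i j).im = 0) (i k : ℕ) :
    (bandMatrix σ i k : ℂ) = σ.inner (ptilde σ i) ((X : ℂ[X]) • ptilde σ k) :=
  Complex.ext rfl (inner_im_eq_zero h hreal (ptilde_mem_realVectors h hreal i)
    (X_smul_mem_realVectors (ptilde_mem_realVectors h hreal k))).symm

theorem bandMatrix_symm (h : σ.FiniteMoments) (i k : ℕ) :
    bandMatrix σ i k = bandMatrix σ k i := by
  rw [bandMatrix, bandMatrix, ← inner_conj_symm h, inner_poly_smul_left h, conjPoly,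
    Polynomial.map_X, Complex.conj_re]

/-- `z ptilde k` has height at most `height k + n`, so it is orthogonal to the later `ptilde i`. -/
theorem bandMatrix_eq_zero (hσ : σ.InClass) {i k : ℕ}
    (hik : rankBelow σ (height σ k + n + 1) ≤ i) : bandMatrix σ i k = 0 := by
  have hle := le_height hσ hik
  rw [bandMatrix, ← sub_add_cancel ((X : ℂ[X]) • ptilde σ k)
    ((normFactor σ k : ℂ) • gs σ (height σ k + n)), inner_ptilde_of_mem_lowSpan hσ.finite_moments,
    Complex.zero_re]
  refine lowSpan_mono hle (add_mem (lowSpan_mono (Nat.le_succ _) (X_smul_ptilde_sub_mem σ k)) ?_)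
  exact Submodule.smul_mem _ _ (gs_mem_lowSpan σ (Nat.lt_succ_self _))

theorem rankBelow_succ (k : ℕ) : rankBelow σ (height σ k + n + 1) =
    rankBelow σ (height σ k + n) + if IsDefect σ k then 0 else 1 := by
  rw [rankBelow, Nat.count_succ, rankBelow]
  by_cases h : IsDefect σ k
  · rw [if_pos h, if_neg h]
  · rw [if_neg h, if_pos (not_not.mp h)]

/-- The leading term of `z ptilde k` is a positive multiple of that of the `ptilde i` of the same
height. -/
theorem bandMatrix_pos (hσ : σ.InClass) {k : ℕ} (hk : ¬ IsDefect σ k) :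
    0 < bandMatrix σ (rankBelow σ (height σ k + n)) k := by
  have h := hσ.finite_moments
  have hne : σ.normSq (gs σ (height σ k + n)) ≠ 0 := not_not.mp hk
  have hheight := height_rankBelow hne
  rw [bandMatrix, ← sub_add_cancel ((X : ℂ[X]) • ptilde σ k)
    ((normFactor σ k : ℂ) • gs σ (height σ k + n)), inner_add_right h,
    inner_ptilde_of_mem_lowSpan h (hheight.symm ▸ X_smul_ptilde_sub_mem σ k), zero_add, ptilde_eq,
    hheight, inner_smul_left h, inner_smul_right h, ← ofReal_normSq h, Complex.conj_ofReal,
    ← Complex.ofReal_mul, ← Complex.ofReal_mul, Complex.ofReal_re]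
  exact mul_pos (normFactor_pos hσ _) (mul_pos (normFactor_pos hσ _)
    ((normSq_nonneg h _).lt_of_ne' hne))

theorem finite_isDefect (hσ : σ.InClass) : (Set.ofPred (IsDefect σ)).Finite :=
  finite_of_count_lt (count_isDefect_lt hσ)

theorem bandMatrix_eq_zero_of_lt (hσ : σ.InClass) {i k : ℕ}
    (hik : k + n < i + Nat.count (IsDefect σ) k) : bandMatrix σ i k = 0 := by
  refine bandMatrix_eq_zero hσ ?_
  have := rankBelow_add_count hσ k
  rw [rankBelow_succ]
  split_ifs <;> omega

theorem isDegenerateBand_bandMatrix (hσ : σ.InClass) :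
    IsDegenerateBand n (bandMatrix σ) (finite_isDefect hσ).toFinset.card
      fun j => Nat.nth (IsDefect σ) j := by
  refine isDegenerateBand_of_count (count_isDefect_lt hσ) _ (bandMatrix_symm hσ.finite_moments)
    (fun i k => bandMatrix_eq_zero_of_lt hσ) (fun i k hD hik => ?_) fun i k hD hik => ?_
  · refine bandMatrix_eq_zero hσ ?_
    have := rankBelow_add_count hσ k
    rw [rankBelow_succ, if_pos hD]
    omega
  · have hpos := bandMatrix_pos hσ hD
    have := rankBelow_add_count hσ k
    rwa [show rankBelow σ (height σ k + n) = i by omega] at hpos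

end Orthonormal

/-! ### The recurrence modulo null vectors -/

section Recurrence

variable {n : ℕ} [NeZero n] {σ : MatrixDistribution n}

variable (σ) in
/-- The module over the scalar polynomials generated by the null vectors of the Gram-Schmidt
procedure. -/
noncomputable def nullSpan : Submodule ℂ[X] (Fin n → ℂ[X]) :=
  Submodule.span ℂ[X] (gs σ '' {j | IsNullStep σ j})

theorem nullSpan_le (h : σ.FiniteMoments) : nullSpan σ ≤ nullSubmodule h := by
  refine Submodule.span_le.mpr ?_
  rintro _ ⟨j, hj, rfl⟩
  exact (normSq_eq_zero h).mp hj.1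

/-- Every step of zero norm is a shift of a null step, the first step of zero norm in its class
modulo `n`. -/
theorem exists_isNullStep {k : ℕ} (hk : σ.normSq (gs σ k) = 0) :
    ∃ j l, IsNullStep σ j ∧ k = j + n * l := by
  classical
  have hex : ∃ j, σ.normSq (gs σ j) = 0 ∧ j ≡ k [MOD n] := ⟨k, hk, rfl⟩
  obtain ⟨h1, h2⟩ := Nat.find_spec hex
  have hle : Nat.find hex ≤ k := Nat.find_min' hex ⟨hk, rfl⟩
  obtain ⟨l, hl⟩ := (Nat.modEq_iff_dvd' hle).mp h2
  refine ⟨Nat.find hex, l, ⟨h1, fun i hi h0 hmod => ?_⟩, by omega⟩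
  exact Nat.find_min hex hi ⟨h0, hmod.trans h2⟩

/-- The orthonormal sequence spans the space of vector polynomials up to the module generated by
the null vectors. -/
theorem span_ptilde_sup_nullSpan (hσ : σ.InClass) :
    Submodule.span ℂ (Set.range (ptilde σ)) ⊔ (nullSpan σ).restrictScalars ℂ = ⊤ := by
  refine eq_top_of_canon_mem fun k hk => ?_
  by_cases h0 : σ.normSq (gs σ k) = 0
  · obtain ⟨j, l, hj, rfl⟩ := exists_isNullStep h0
    rw [← sub_sub_cancel ((X : ℂ[X]) ^ l • gs σ j) (canon n (j + n * l))]
    refine sub_mem (Submodule.mem_sup_right ?_) (hk ?_)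
    · exact Submodule.smul_mem (nullSpan σ) _ (Submodule.subset_span ⟨j, hj, rfl⟩)
    · rw [← X_pow_smul_canon, ← smul_sub]
      exact X_pow_smul_mem_lowSpan (gs_sub_canon_mem σ j) l
  · rw [← sub_sub_cancel (gs σ k) (canon n k)]
    refine sub_mem (Submodule.mem_sup_left ?_) (hk (gs_sub_canon_mem σ k))
    have hc := (normFactor_pos hσ (rankBelow σ k)).ne'
    have hg : gs σ k = ((normFactor σ (rankBelow σ k) : ℂ))⁻¹ • ptilde σ (rankBelow σ k) := by
      rw [ptilde_eq, inv_smul_smul₀ (Complex.ofReal_ne_zero.mpr hc), height_rankBelow h0]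
    rw [hg]
    exact Submodule.smul_mem _ _ (Submodule.subset_span ⟨_, rfl⟩)

theorem inner_ptilde_sum (hσ : σ.InClass) (i : ℕ) (s : Finset ℕ) (a : ℕ → ℂ) :
    σ.inner (ptilde σ i) (∑ l ∈ s, a l • ptilde σ l) = if i ∈ s then a i else 0 := by
  change innerRight hσ.finite_moments _ _ = _
  rw [map_sum]
  have (l : ℕ) : innerRight hσ.finite_moments (ptilde σ i) (a l • ptilde σ l) =
      if i = l then a l else 0 := by
    rw [map_smul]
    change a l * σ.inner _ _ = _
    rw [inner_ptilde_ptilde hσ]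
    split_ifs <;> simp
  simp only [this, Finset.sum_ite_eq]

/-- The recurrence coefficients are the matrix entries of multiplication by `z`, since the null
vectors do not contribute to inner products. -/
theorem IsRecurrenceCoeff.eq_inner (hσ : σ.InClass) {c : ℕ → ℕ → ℂ}
    (hc : IsRecurrenceCoeff σ c) (i k : ℕ) :
    c i k = σ.inner (ptilde σ i) ((X : ℂ[X]) • ptilde σ k) := by
  have h := hσ.finite_moments
  obtain ⟨L, R, hL, hR, heq⟩ := hc k
  have hnull : (R.sum fun j r => r • gs σ j) ∈ nullSubmodule h :=
    Submodule.sum_mem _ fun j hj => Submodule.smul_mem _ _ ((normSq_eq_zero h).mp (hR j hj).1)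
  rw [heq, inner_add_right h, inner_eq_zero_of_inner_self_right h hnull, add_zero,
    inner_ptilde_sum hσ]
  split_ifs with hi
  · rfl
  · exact hL i (by simpa using hi)

theorem isRecurrenceCoeff_inner (hσ : σ.InClass) :
    IsRecurrenceCoeff σ fun i k => σ.inner (ptilde σ i) ((X : ℂ[X]) • ptilde σ k) := by
  have h := hσ.finite_moments
  intro k
  have hmem : (X : ℂ[X]) • ptilde σ k ∈
      Submodule.span ℂ (Set.range (ptilde σ)) ⊔ (nullSpan σ).restrictScalars ℂ := by
    rw [span_ptilde_sup_nullSpan hσ]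
    exact Submodule.mem_top
  obtain ⟨x, hx, y, hy, hxy⟩ := Submodule.mem_sup.mp hmem
  obtain ⟨a, rfl⟩ := Finsupp.mem_span_range_iff_exists_finsupp.mp hx
  obtain ⟨R, hR, rfl⟩ := (Finsupp.mem_span_image_iff_linearCombination ℂ[X]).mp hy
  have ha (i : ℕ) : σ.inner (ptilde σ i) ((X : ℂ[X]) • ptilde σ k) = a i := by
    rw [← hxy, inner_add_right h, inner_eq_zero_of_inner_self_right h (nullSpan_le h hy), add_zero,
      Finsupp.sum, inner_ptilde_sum hσ]
    split_ifs with hi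
    · rfl
    · exact (Finsupp.notMem_support_iff.mp hi).symm
  have hsub : a.support ⊆ Finset.range (a.support.sup id + 1) := fun i hi =>
    Finset.mem_range_succ_iff.mpr (Finset.le_sup (f := id) hi)
  refine ⟨a.support.sup id + 1, R, fun i hi => ?_, fun j hj => hR hj, ?_⟩
  · refine (ha i).trans ?_
    refine Finsupp.notMem_support_iff.mp fun hi' => ?_
    exact absurd (Finset.mem_range.mp (hsub hi')) (not_lt.mpr hi)
  · simp only [ha]
    rw [← hxy, ← Finset.sum_subset hsub fun i _ hi => by
      rw [Finsupp.notMem_support_iff.mp hi, zero_smul]]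
    rfl

/-- The recurrence holds up to a null vector, with any range of summation that covers the row. -/
theorem sub_sum_bandMatrix_mem_null (hσ : σ.InClass)
    (hreal : ∀ (k : ℕ) (i j : Fin n), (σ.moment k i j).im = 0) {k L : ℕ}
    (hL : ∀ l, L ≤ l → bandMatrix σ k l = 0) :
    (X : ℂ[X]) • ptilde σ k - ∑ l ∈ Finset.range L, (bandMatrix σ k l : ℂ) • ptilde σ l ∈
      nullSubmodule hσ.finite_moments := by
  have h := hσ.finite_moments
  refine mem_null_of_inner_gs h fun a ha => ?_
  have hp (i : ℕ) : σ.inner (ptilde σ i) ((X : ℂ[X]) • ptilde σ k -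
      ∑ l ∈ Finset.range L, (bandMatrix σ k l : ℂ) • ptilde σ l) = 0 := by
    change innerRight h _ _ = 0
    rw [map_sub]
    change σ.inner _ _ - σ.inner _ _ = 0
    rw [inner_ptilde_sum hσ, ← ofReal_bandMatrix h hreal, bandMatrix_symm h, sub_eq_zero]
    split_ifs with hi
    · rfl
    · rw [hL i (by simpa using hi), Complex.ofReal_zero]
  have := hp (rankBelow σ a)
  rw [ptilde_eq, height_rankBelow ha, inner_smul_left h, mul_eq_zero] at this
  refine this.resolve_left ?_
  rw [Complex.conj_ofReal]
  exact Complex.ofReal_ne_zero.mpr (normFactor_pos hσ _).ne'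

end Recurrence

/-! ### Polynomial solutions and the spectral function -/

section Spectral

variable {n : ℕ} [NeZero n] {σ : MatrixDistribution n}

variable (σ) in
/-- The solution of the recurrence that starts like the orthonormal sequence. The row in which the
`l`th vector has the last nonzero coefficient is the one of height `height l - n`. -/
noncomputable def spectralPolynomial : ℕ → Fin n → ℂ[X] :=
  bandSolution (bandMatrix σ) (fun l => rankBelow σ (height σ l - n)) (ptilde σ)

theorem lt_rankBelow_height_add (hσ : σ.InClass) (k : ℕ) : k < rankBelow σ (height σ k + n) :=
  lt_rankBelow hσ (Nat.lt_add_of_pos_right (Nat.pos_of_ne_zero (NeZero.ne n)))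

theorem le_rankBelow_height_add (hσ : σ.InClass) (k : ℕ) : n ≤ rankBelow σ (height σ k + n) := by
  have := rankBelow_mono (σ := σ) (Nat.le_add_left n (height σ k))
  rwa [rankBelow_of_le hσ le_rfl] at this

theorem bandMatrix_rankBelow_pos (hσ : σ.InClass) {k : ℕ} (hk : ¬ IsDefect σ k) :
    0 < bandMatrix σ k (rankBelow σ (height σ k + n)) := by
  rw [bandMatrix_symm hσ.finite_moments]
  exact bandMatrix_pos hσ hk

theorem bandMatrix_eq_zero_of_rankBelow_lt (hσ : σ.InClass) {k l : ℕ}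
    (hl : rankBelow σ (height σ k + n) < l) : bandMatrix σ k l = 0 := by
  rw [bandMatrix_symm hσ.finite_moments]
  have := rankBelow_add_count hσ k
  exact bandMatrix_eq_zero_of_lt hσ (by omega)

theorem sum_spectralPolynomial (hσ : σ.InClass) {k : ℕ} (hk : ¬ IsDefect σ k) :
    ∑ l ∈ Finset.range (rankBelow σ (height σ k + n) + 1),
      (bandMatrix σ k l : ℂ) • spectralPolynomial σ l = (X : ℂ[X]) • spectralPolynomial σ k := by
  have hrow : rankBelow σ (height σ (rankBelow σ (height σ k + n)) - n) = k := by
    rw [height_rankBelow (not_not.mp hk), Nat.add_sub_cancel, rankBelow_height hσ]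
  have := sum_bandSolution (A := bandMatrix σ) (init := ptilde σ)
    (row := fun l => rankBelow σ (height σ l - n)) (le_rankBelow_height_add hσ k)
  simp only [hrow] at this
  exact this (lt_rankBelow_height_add hσ k) (bandMatrix_rankBelow_pos hσ hk).ne'

/-- The solution of the recurrence represents the orthonormal sequence in `L_2(ℝ, σ)`. -/
theorem spectralPolynomial_sub_ptilde_mem (hσ : σ.InClass)
    (hreal : ∀ (k : ℕ) (i j : Fin n), (σ.moment k i j).im = 0) (l : ℕ) :
    spectralPolynomial σ l - ptilde σ l ∈ nullSubmodule hσ.finite_moments := by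
  have h := hσ.finite_moments
  induction l using Nat.strong_induction_on with
  | _ l ih =>
    rcases lt_or_ge l n with hl | hl
    · rw [spectralPolynomial, bandSolution_of_lt hl, sub_self]
      exact zero_mem _
    -- For `l ≥ n`, `height l = height k + n` with a row `k` that is not degenerate, and this row
    -- expresses the `l`th vector by earlier ones.
    have hn : n ≤ height σ l := le_height hσ (by rwa [rankBelow_of_le hσ le_rfl])
    have hne : σ.normSq (gs σ (height σ l - n)) ≠ 0 := fun h0 => by
      have := normSq_gs_add h h0
      rw [Nat.sub_add_cancel hn] at this
      exact normSq_gs_height_ne_zero hσ l this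
    obtain ⟨k, hk⟩ : ∃ k, height σ k + n = height σ l :=
      ⟨rankBelow σ (height σ l - n), by rw [height_rankBelow hne, Nat.sub_add_cancel hn]⟩
    have hkl : rankBelow σ (height σ k + n) = l := by rw [hk, rankBelow_height hσ]
    have hD : ¬ IsDefect σ k := by
      rw [IsDefect, hk]
      exact not_not.mpr (normSq_gs_height_ne_zero hσ l)
    have h1 := sum_spectralPolynomial hσ hD
    have h2 := sub_sum_bandMatrix_mem_null hσ hreal (k := k)
      (L := rankBelow σ (height σ k + n) + 1)
      fun _ hi => bandMatrix_eq_zero_of_rankBelow_lt hσ (Nat.lt_of_succ_le hi)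
    have hA := (bandMatrix_rankBelow_pos hσ hD).ne'
    have hlt := lt_rankBelow_height_add hσ k
    rw [hkl] at h1 h2 hA hlt
    rw [Finset.sum_range_succ] at h1 h2
    have h3 : (X : ℂ[X]) • (spectralPolynomial σ k - ptilde σ k) -
        ∑ i ∈ Finset.range l, (bandMatrix σ k i : ℂ) • (spectralPolynomial σ i - ptilde σ i) ∈
        nullSubmodule h := by
      refine sub_mem (Submodule.smul_mem _ _ (ih k hlt)) (Submodule.sum_mem _ fun i hi => ?_)
      exact Submodule.smul_of_tower_mem _ _ (ih i (Finset.mem_range.mp hi))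
    have h4 : (bandMatrix σ k l : ℂ) • (spectralPolynomial σ l - ptilde σ l) ∈
        nullSubmodule h := by
      convert add_mem h2 h3 using 1
      simp only [smul_sub, Finset.sum_sub_distrib]
      rw [← h1]
      abel
    have h5 := Submodule.smul_of_tower_mem _ ((bandMatrix σ k l : ℂ))⁻¹ h4
    rwa [inv_smul_smul₀ (Complex.ofReal_ne_zero.mpr hA)] at h5

/-- The first `n` vectors of the orthonormal sequence are constant, and they are the columns of a real
upper triangular matrix with nonzero diagonal. -/
theorem exists_real_ptilde (hσ : σ.InClass)
    (hreal : ∀ (k : ℕ) (i j : Fin n), (σ.moment k i j).im = 0) (k : Fin n) :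
    ∃ v : Fin n → ℝ, ptilde σ k = (fun i => C ((v i : ℝ) : ℂ)) ∧ (∀ i, k < i → v i = 0) ∧
      v k ≠ 0 := by
  have h := hσ.finite_moments
  obtain ⟨v, hv, hv0⟩ := exists_const_of_mem_lowSpan k.2.le (gs_sub_canon_mem σ k)
  have hp : ptilde σ k =
      fun i => C ((normFactor σ k : ℂ) * ((Pi.single k 1 + v : Fin n → ℂ) i)) := by
    rw [ptilde_eq, height_of_lt hσ k.2, ← sub_add_cancel (gs σ k) (canon n k), hv,
      canon_of_lt k k.2]
    ext1 i
    simp [Pi.single_apply, apply_ite C, add_comm, smul_eq_C_mul, mul_add]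
  have hre := ptilde_mem_realVectors h hreal k
  refine ⟨fun i => ((normFactor σ k : ℂ) * ((Pi.single k 1 + v : Fin n → ℂ) i)).re, ?_, ?_, ?_⟩
  · rw [hp]
    ext1 i
    have := hre i
    rw [hp, Polynomial.map_C] at this
    rw [Complex.conj_eq_iff_re.mp (C_injective this)]
  · intro i hi
    simp [hv0 i hi.le, Pi.single_eq_of_ne hi.ne']
  · simp [hv0 k le_rfl, (normFactor_pos hσ k).ne']

theorem isSpectralFunction_bandMatrix (hσ : σ.InClass)
    (hreal : ∀ (k : ℕ) (i j : Fin n), (σ.moment k i j).im = 0) :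
    IsSpectralFunction σ (bandMatrix σ) := by
  have h := hσ.finite_moments
  have hband := isDegenerateBand_bandMatrix hσ
  choose v hv hv0 hvk using exists_real_ptilde hσ hreal
  refine ⟨h, hσ.isUnit_moment_zero, _, _, hband, Matrix.of fun i k => v k i,
    spectralPolynomial σ, ⟨fun i j hij => hv0 j i hij, Finset.prod_ne_zero_iff.mpr fun i _ => hvk i⟩,
    ⟨fun k => ?_, fun k hk => ?_⟩, fun k l => ?_, fun j => ?_⟩
  · rw [spectralPolynomial, bandSolution_of_lt k.2, hv]
    rfl
  · have hD : ¬ IsDefect σ k := fun hD =>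
      hk ⟨Nat.count (IsDefect σ) k, Nat.count_lt_card _ hD⟩ (Nat.nth_count hD)
    rw [← sum_spectralPolynomial hσ hD]
    have hle := rankBelow_add_count hσ k
    refine (Finset.sum_subset (Finset.range_mono (by omega)) fun l _ hl => ?_).symm
    rw [bandMatrix_eq_zero_of_rankBelow_lt hσ (by simpa using hl), Complex.ofReal_zero, zero_smul]
  · rw [inner_congr_left h (spectralPolynomial_sub_ptilde_mem hσ hreal k),
      inner_congr_right h (spectralPolynomial_sub_ptilde_mem hσ hreal l), inner_ptilde_ptilde hσ]
    -- All entries of the row `m j` from the column `m j + n - j` on vanish.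
  · have hj : Nat.count (IsDefect σ) (Nat.nth (IsDefect σ) j) = j := Nat.count_nth fun _ => j.2
    have hD : IsDefect σ (Nat.nth (IsDefect σ) j) := Nat.nth_mem j fun _ => j.2
    have h1 := sub_sum_bandMatrix_mem_null hσ hreal (k := Nat.nth (IsDefect σ) j)
      (L := Nat.nth (IsDefect σ) j + (n - j)) fun l hl => by
        rw [bandMatrix_symm h]
        refine bandMatrix_eq_zero hσ ?_
        have := rankBelow_add_count hσ (Nat.nth (IsDefect σ) j)
        rw [rankBelow_succ, if_pos hD]
        omega
    have h2 : (X : ℂ[X]) • (spectralPolynomial σ (Nat.nth (IsDefect σ) j) -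
          ptilde σ (Nat.nth (IsDefect σ) j)) -
        ∑ i ∈ Finset.range (Nat.nth (IsDefect σ) j + (n - j)),
          (bandMatrix σ (Nat.nth (IsDefect σ) j) i : ℂ) •
            (spectralPolynomial σ i - ptilde σ i) ∈ nullSubmodule h := by
      refine sub_mem (Submodule.smul_mem _ _ (spectralPolynomial_sub_ptilde_mem hσ hreal _))
        (Submodule.sum_mem _ fun i hi => ?_)
      exact Submodule.smul_of_tower_mem _ _ (spectralPolynomial_sub_ptilde_mem hσ hreal i)
    rw [← mem_nullSubmodule h]
    convert add_mem h1 h2 using 1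
    simp only [qpoly, smul_sub, Finset.sum_sub_distrib]
    abel

theorem inBandClass_bandMatrix (hσ : σ.InClass)
    (hcanon : ∀ a : Fin n → ℂ, σ.normSq (canon n n + fun i => C (a i)) ≠ 0) :
    InBandClass n (bandMatrix σ) := by
  refine ⟨_, _, isDegenerateBand_bandMatrix hσ, fun j => Nat.pos_of_ne_zero fun h0 => ?_⟩
  have hD : IsDefect σ (Nat.nth (IsDefect σ) j) := Nat.nth_mem j fun _ => j.2
  rw [h0, IsDefect, height_of_lt hσ (Nat.pos_of_ne_zero (NeZero.ne n)), zero_add] at hD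
  obtain ⟨a, ha, -⟩ := exists_const_of_mem_lowSpan le_rfl (gs_sub_canon_mem σ n)
  refine hcanon a ?_
  rw [← ha, add_sub_cancel]
  exact not_not.mp hD

end Spectral

end BandSpectral

theorem theorem4 (n : ℕ) [NeZero n] (σ : BandSpectral.MatrixDistribution n) (hσ : σ.InClass)
    (hreal : ∀ (k : ℕ) (i j : Fin n), (σ.moment k i j).im = 0) :
    (∃! c : ℕ → ℕ → ℂ, BandSpectral.IsRecurrenceCoeff σ c) ∧
    ∀ c : ℕ → ℕ → ℂ, BandSpectral.IsRecurrenceCoeff σ c →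
      ∃ A : ℕ → ℕ → ℝ, (∀ k l, c k l = ((A k l : ℝ) : ℂ)) ∧
        BandSpectral.IsSpectralFunction σ A ∧
        ((∀ a : Fin n → ℂ,
            σ.normSq (BandSpectral.canon n n + fun i => Polynomial.C (a i)) ≠ 0) →
          BandSpectral.InBandClass n A) := by
  refine ⟨⟨_, BandSpectral.isRecurrenceCoeff_inner hσ, fun c hc => ?_⟩, fun c hc => ?_⟩
  · ext i k
    exact hc.eq_inner hσ i k
  · refine ⟨BandSpectral.bandMatrix σ, fun k l => ?_,
      BandSpectral.isSpectralFunction_bandMatrix hσ hreal,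
      BandSpectral.inBandClass_bandMatrix hσ⟩
    rw [BandSpectral.ofReal_bandMatrix hσ.finite_moments hreal, hc.eq_inner hσ]
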